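/- For a group $W$ with a set $S$ of simple generators making it a Coxeter system with length function $\ell$, let $\circ$ be the Demazure product on $W$, i.e. the unique associative product with $s\circ s=s$ for $s\in S$ and $u\circ v=uv$ whenever $\ell(uv)=\ell(u)+\ell(v)$. For an involution $z\in\mathcal I(W)=\{w\in W: w^{-1}=w\}$ let $\mathcal A(z)$ be the set of elements of minimal length in $\{w\in W : w^{-1}\circ w=z\}$, and let $\mathcal A(z)^{-1}=\{w^{-1}:w\in\mathcal A(z)\}$. Let $n\ge 0$, $[\pm n]=\{\pm1,\dots,\pm n\}$, and let $W_n$ be the group of permutations $w$ of $[\pm n]$ with $w(-i)=-w(i)$ for all $i$, with simple generators $t_0=(-1,1)$ (if $n\ge 1$) and $t_i=(-i,-i-1)(i,i+1)$ for $1\le i<n$; the one-line representation of $w\in W_n$ is the word $w(1)w(2)\cdots w(n)$. For a finite set $X=\{x_1<\dots<x_m\}$ of integers let $S_X$ be the group of permutations of $X$, with simple generators $(x_i,x_{i+1})$ for $1\le i<m$; the one-line representation of $\sigma\in S_X$ is the word $\sigma(x_1)\cdots\sigma(x_m)$. Write $S_n=S_{\{1,\dots,n\}}$. If $[\pm n]=X\sqcup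 -X$, then the one-line representation of each $\sigma\in S_X$ is also that of a unique element of $W_n$; for $\zeta\in\mathcal I(S_X)$ let $\mathcal W_{\tt embed}(\zeta)\subseteq W_n$ be the image of $\mathcal A(\zeta)^{-1}$ under this inclusion $S_X\hookrightarrow W_n$. On words of integers let $<_A$ be the transitive closure of the relation $\cdots cab\cdots\vartriangleleft_A\cdots bca\cdots$ ($a<b<c$ consecutive letters, all other letters unchanged), let $\le_A$ be its reflexive closure, and let $\sim_A$ be the equivalence relation generated by $<_A$. Apply these relations to elements of $W_n$ and $S_X$ through their one-line representations. **Corollary.** Let $z\in\mathcal I(W_n)$ and let $\mathcal E$ be an equivalence class in $\mathcal A(z)^{-1}$ under $\sim_A$. Then: 1. There are a set $X$ with $[\pm n]=X\sqcup -X$ and an involution $\zeta\in\mathcal I(S_X)$ such that $\mathcal E=\mathcal W_{\tt embed}(\zeta)$, and $(\mathcal E,<_A)$ is isomorphic to $(\mathcal A(\zeta)^{-1},<_A)$. 2. $\mathcal E$ has a unique minimal element and a unique maximal element under $<_A$; these are the (unique) minimum and maximum of $\mathcal E$, i.e. every $w\in\mathcal E$ lies between them with respect to $\le_A$. 3. There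 is an involution $\zeta'\in\mathcal I(S_n)$ such that $(\mathcal E,<_A)$ is isomorphic to $(\mathcal A(\zeta')^{-1},<_A)$. -/

import Mathlib

namespace SignedAtoms

section CoxeterGeneralities

variable {G : Type*} [Group G]

/-- `l` is a word in the generating set `S` whose product is `g`. -/
def IsWordFor (S : Set G) (l : List G) (g : G) : Prop :=
  (∀ s ∈ l, s ∈ S) ∧ l.prod = g

/-- The length `ℓ(g)`: the least number of factors in a word for `g` in the generators `S`. -/
noncomputable def length (S : Set G) (g : G) : ℕ :=
  sInf {k : ℕ | ∃ l : List G, IsWordFor S l g ∧ l.length = k}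

/-- Reduced words of `g`. -/
def IsReducedWord (S : Set G) (l : List G) (g : G) : Prop :=
  IsWordFor S l g ∧ l.length = length S g

open Classical in
/-- The Demazure product `w ∘ s` with a simple generator `s`:
it is `w s` if `ℓ(w s) > ℓ(w)`, and `w` otherwise. -/
noncomputable def demazureStep (S : Set G) (w s : G) : G :=
  if length S w < length S (w * s) then w * s else w

open Classical in
/-- The Demazure product `u ∘ v = (⋯((u ∘ s₁) ∘ s₂) ⋯) ∘ s_l`, where `s₁ s₂ ⋯ s_l` is a reduced word
of `v`. In a Coxeter group the result is the same for all reduced words of `v`, and `∘` is the unique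
associative product with `s ∘ s = s` for simple `s` and `u ∘ v = u v` when `ℓ(u v) = ℓ(u) + ℓ(v)`.
(The second branch never occurs when `S` generates the group as a monoid.) -/
noncomputable def demazure (S : Set G) (u v : G) : G :=
  if h : ∃ l : List G, IsReducedWord S l v then h.choose.foldl (demazureStep S) u else u * v

/-- The Hecke atoms of `z`: the elements `w` with `w⁻¹ ∘ w = z`. -/
def heckeAtoms (S : Set G) (z : G) : Set G :=
  {w | demazure S w⁻¹ w = z}

/-- The atoms of `z`: the elements of minimal length among the Hecke atoms. -/
def atoms (S : Set G) (z : G) : Set G :=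
  {w | w ∈ heckeAtoms S z ∧ ∀ v ∈ heckeAtoms S z, length S w ≤ length S v}

/-- The set `𝒜(z)⁻¹` of inverses of the atoms of `z`. -/
def invAtoms (S : Set G) (z : G) : Set G :=
  {w | w⁻¹ ∈ atoms S z}

end CoxeterGeneralities

section Words

/-- The relation `⋯cab⋯ ◁_A ⋯bca⋯` (with `a < b < c`) on words. -/
def CoverA (v w : List ℤ) : Prop :=
  ∃ (p q : List ℤ) (a b c : ℤ), a < b ∧ b < c ∧
    v = p ++ [c, a, b] ++ q ∧ w = p ++ [b, c, a] ++ q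

/-- `<_A`, the transitive closure of `◁_A`. -/
def LtA : List ℤ → List ℤ → Prop := Relation.TransGen CoverA

/-- `≤_A`, the reflexive closure of `<_A`. -/
def LeA (v w : List ℤ) : Prop := v = w ∨ LtA v w

/-- `∼_A`, the equivalence relation generated by `<_A`. -/
def SimA : List ℤ → List ℤ → Prop := Relation.EqvGen LtA

end Words

section TypeA

/-- The simple generators of `S_X`: the transpositions of two consecutive elements of `X`. -/
def simpleA (X : Finset ℤ) : Set (Equiv.Perm X) :=
  {s | ∃ a b : X, a ⋖ b ∧ s = Equiv.swap a b}

/-- The one-line representation `σ(x₁) σ(x₂) ⋯ σ(x_m)` of `σ ∈ S_X`, where `x₁ < ⋯ < x_m` are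
the elements of `X`. -/
noncomputable def oneLineA {X : Finset ℤ} (σ : Equiv.Perm X) : List ℤ :=
  List.ofFn fun i : Fin X.card => (σ (X.orderIsoOfFin rfl i) : ℤ)

end TypeA

section TypeB

/-- The set `[±n] = {-n, …, -1, 1, …, n}`. -/
noncomputable def pm (n : ℕ) : Finset ℤ := (Finset.Icc (-(n : ℤ)) n).erase 0

theorem mem_pm {n : ℕ} {i : ℤ} : i ∈ pm n ↔ i ≠ 0 ∧ -(n : ℤ) ≤ i ∧ i ≤ n := by
  simp [pm]

/-- Negation on `[±n]`. -/
instance (n : ℕ) : Neg (pm n) :=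
  ⟨fun i => ⟨-(i : ℤ), by have h := mem_pm.1 i.2; rw [mem_pm]; omega⟩⟩

theorem coe_neg_pm {n : ℕ} (i : pm n) : ((-i : pm n) : ℤ) = -(i : ℤ) := rfl

/-- The hyperoctahedral group `W_n` of permutations `w` of `[±n]` with `w(-i) = -w(i)`. -/
def hyperoctahedral (n : ℕ) : Subgroup (Equiv.Perm (pm n)) where
  carrier := {w | ∀ i, w (-i) = -w i}
  one_mem' := fun _ => rfl
  mul_mem' := by
    intro u v hu hv i
    change u (v (-i)) = -u (v i)
    rw [hv, hu]
  inv_mem' := by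
    intro u hu i
    change u.symm (-i) = -u.symm i
    rw [Equiv.symm_apply_eq, hu, Equiv.apply_symm_apply]

/-- The simple generators `t₀ = (-1, 1)` and `t_i = (-i, -i-1)(i, i+1)`, for `1 ≤ i < n`, of `W_n`. -/
def simpleB (n : ℕ) : Set (hyperoctahedral n) :=
  {t | (∃ a : pm n, (a : ℤ) = 1 ∧ (t : Equiv.Perm (pm n)) = Equiv.swap (-a) a) ∨
    (∃ a b : pm n, 0 < (a : ℤ) ∧ (b : ℤ) = a + 1 ∧
      (t : Equiv.Perm (pm n)) = Equiv.swap (-a) (-b) * Equiv.swap a b)}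

/-- The element `i + 1` of `[±n]`, for `0 ≤ i < n`. -/
def pos {n : ℕ} (i : Fin n) : pm n :=
  ⟨(i : ℤ) + 1, by have := i.2; rw [mem_pm]; omega⟩

/-- The one-line representation `w(1) w(2) ⋯ w(n)` of `w ∈ W_n`. -/
def oneLineB {n : ℕ} (w : hyperoctahedral n) : List ℤ :=
  List.ofFn fun i : Fin n => ((w : Equiv.Perm (pm n)) (pos i) : ℤ)

/-- `[±n] = X ⊔ -X`. -/
def IsHalf (n : ℕ) (X : Finset ℤ) : Prop :=
  X ∪ X.image (fun x => -x) = pm n ∧ Disjoint X (X.image fun x => -x)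

theorem IsHalf.card {n : ℕ} {X : Finset ℤ} (hX : IsHalf n X) : X.card = n := by
  have h := congrArg Finset.card hX.1
  rw [Finset.card_union_of_disjoint hX.2, Finset.card_image_of_injective _ neg_injective] at h
  have h2 : (pm n).card = 2 * n := by
    rw [pm, Finset.card_erase_of_mem (by simp)]
    simp; omega
  omega

theorem oneLineB_injective {n : ℕ} : Function.Injective (oneLineB (n := n)) := by
  intro u v h
  have h1 := List.ofFn_injective h
  apply Subtype.ext
  apply Equiv.ext
  have key : ∀ i : Fin n, (u : Equiv.Perm (pm n)) (pos i) = (v : Equiv.Perm (pm n)) (pos i) :=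
    fun i => Subtype.ext (congrFun h1 i)
  intro x
  have hx := mem_pm.1 x.2
  rcases lt_or_gt_of_ne hx.1 with hneg | hpos
  · have e : x = -pos (n := n) ⟨(-(x : ℤ) - 1).toNat, by omega⟩ := by
      apply Subtype.ext; rw [coe_neg_pm]; simp only [pos]; omega
    rw [e, u.2, v.2, key]
  · have e : x = pos (n := n) ⟨((x : ℤ) - 1).toNat, by omega⟩ := by
      apply Subtype.ext; simp only [pos]; omega
    rw [e, key]

/-- The one-line representation of each `σ ∈ S_X` is that of an element of `W_n`. -/
theorem exists_oneLineB_eq {n : ℕ} {X : Finset ℤ} (hX : IsHalf n X) (σ : Equiv.Perm X) :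
    ∃ w : hyperoctahedral n, oneLineB w = oneLineA σ := by
  have hc := hX.card
  subst hc
  have memX : ∀ x ∈ X, x ∈ pm X.card := fun x hx => by
    have : x ∈ X ∪ X.image (fun x => -x) := Finset.mem_union_left _ hx
    rwa [hX.1] at this
  have negX : ∀ x ∈ X, ∀ y ∈ X, x ≠ -y := fun x hx y hy e =>
    Finset.disjoint_left.1 hX.2 hx (Finset.mem_image.2 ⟨y, hy, e.symm⟩)
  let g : Fin X.card → pm X.card := fun i =>
    ⟨(σ (X.orderIsoOfFin rfl i) : ℤ), memX _ (σ (X.orderIsoOfFin rfl i)).2⟩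
  have gX : ∀ i, (g i : ℤ) ∈ X := fun i => (σ (X.orderIsoOfFin rfl i)).2
  have ginj : ∀ i j, (g i : ℤ) = g j → i = j := fun i j h =>
    (X.orderIsoOfFin rfl).injective (σ.injective (Subtype.ext h))
  let f : pm X.card → pm X.card := fun x =>
    if h : 0 < (x : ℤ) then g ⟨((x : ℤ) - 1).toNat, by have := mem_pm.1 x.2; omega⟩
    else -g ⟨(-(x : ℤ) - 1).toNat, by have := mem_pm.1 x.2; omega⟩
  have finj : Function.Injective f := by
    intro x y h
    have hx := mem_pm.1 x.2
    have hy := mem_pm.1 y.2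
    have h' := congrArg (Subtype.val) h
    simp only [f] at h'
    apply Subtype.ext
    split_ifs at h' with a b b
    · have := congrArg Fin.val (ginj _ _ h'); simp only at this; omega
    · exact absurd h' (negX _ (gX _) _ (gX _))
    · exact absurd h'.symm (negX _ (gX _) _ (gX _))
    · rw [coe_neg_pm, coe_neg_pm] at h'
      have := congrArg Fin.val (ginj _ _ (neg_injective h')); simp only at this; omega
  refine ⟨⟨Equiv.ofBijective f (Finite.injective_iff_bijective.1 finj), ?_⟩, ?_⟩
  · intro x
    have hx := mem_pm.1 x.2
    apply Subtype.ext
    simp only [Equiv.ofBijective_apply, f, coe_neg_pm]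
    split_ifs with a b b
    · omega
    · simp only [coe_neg_pm, neg_neg]
    · simp only [coe_neg_pm, neg_neg]
    · omega
  · unfold oneLineB oneLineA
    congr 1
    funext i
    have : (0 : ℤ) < ((pos i : pm X.card) : ℤ) := by simp only [pos]; omega
    simp only [Equiv.ofBijective_apply, f, this, dif_pos, g]
    congr 4
    simp [pos]

/-- The inclusion `S_X ↪ W_n`, for `[±n] = X ⊔ -X`, that preserves one-line representations. -/
noncomputable def embed {n : ℕ} {X : Finset ℤ} (hX : IsHalf n X) (σ : Equiv.Perm X) :
    hyperoctahedral n :=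
  (exists_oneLineB_eq hX σ).choose

theorem oneLineB_embed {n : ℕ} {X : Finset ℤ} (hX : IsHalf n X) (σ : Equiv.Perm X) :
    oneLineB (embed hX σ) = oneLineA σ :=
  (exists_oneLineB_eq hX σ).choose_spec

/-- `𝒲_embed(ζ)`: the image of `𝒜(ζ)⁻¹ ⊆ S_X` under the inclusion `S_X ↪ W_n`. -/
def embedSet {n : ℕ} {X : Finset ℤ} (hX : IsHalf n X) (ζ : Equiv.Perm X) :
    Set (hyperoctahedral n) :=
  embed hX '' invAtoms (simpleA X) ζ

/-- `E` is an equivalence class of the restriction of `∼_A` to `𝒜(z)⁻¹`, where `z ∈ W_n`. -/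
def IsSimClass {n : ℕ} (z : hyperoctahedral n) (E : Set (hyperoctahedral n)) : Prop :=
  ∃ v ∈ invAtoms (simpleB n) z,
    E = {w | w ∈ invAtoms (simpleB n) z ∧ SimA (oneLineB v) (oneLineB w)}

/-- `(E, <_A)`, for `E ⊆ W_n`, is isomorphic to `(𝒜(ζ)⁻¹, <_A)`, where `ζ ∈ S_X`. -/
def IsoAtomPoset {n : ℕ} (E : Set (hyperoctahedral n)) {X : Finset ℤ} (ζ : Equiv.Perm X) : Prop :=
  ∃ e : E ≃ invAtoms (simpleA X) ζ, ∀ v w : E,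
    LtA (oneLineB v.1) (oneLineB w.1) ↔ LtA (oneLineA (e v).1) (oneLineA (e w).1)

end TypeB

end SignedAtoms

/-! The rank function `#{k : a ≤ k, σ k < b}` turns the Demazure product into a min-plus matrix
product (`HasRankSteps.rank_demazure`). Hence the rank function of `w ∘ w⁻¹` is `splitMin a b` of
the word of `w` (`HasRankSteps.rank_demazure_inv`), and the inverse atoms of `z` are the shortest
words with a prescribed `splitMin`.

Replacing `cab` by `bca` changes neither `splitMin` nor the number of inversions. Replacing `cba` by
`cab` keeps `splitMin` and loses an inversion. So no word equivalent to an inverse atom contains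
`cba` (`IsDescentFree`). A minimal word of such a class contains neither `bca` nor `cba`
(`IsBottom`), so its least letter is first or second; peeling off least letters shows that
`splitMin` determines the word (`IsBottom.eq_of_splitMin_eq`). Thus two descent-free rearrangements
with equal `splitMin` have a common lower bound. This gives the minimum of a class, and the maximum
by the symmetry `negRev`. In `S_X` it also shows that a descent-free class is the whole of `𝒜(ζ)⁻¹`
with `ζ = σ ∘ σ⁻¹` (`exists_invAtomsA_eq`).

An element of `W_n` with one-line word `u` is a permutation of `[±n]` with word `negRev u ++ u`. Its
Demazure steps are those of `[±n]` at mirrored places, and twice its length is the number of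
inversions of the doubled word plus the number of negative letters of `u`. A move in `u` is a pair
of moves in the doubled word, so `𝒜(z)⁻¹` is closed under `∼_A` and its classes are descent-free.
Therefore `E` is a full descent-free class of words on a half `X` of `[±n]`, to which the result for
`S_X` applies; an increasing relabelling replaces `X` by `{1, …, n}`. -/

namespace SignedAtoms

/-! ### The invariant `splitMin` of words -/

section SplitMin

/-- The minimum of `#{x ∈ p | a ≤ x} + #{x ∈ q | x < b}` over all splittings `l = p ++ q`. -/
def splitMin (a b : ℤ) : List ℤ → ℕ
  | [] => 0
  | x :: t => min ((x :: t).countP (· < b)) ((if a ≤ x then 1 else 0) + splitMin a b t)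

theorem splitMin_le_countP (a b : ℤ) (l : List ℤ) : splitMin a b l ≤ l.countP (· < b) := by
  cases l with
  | nil => simp [splitMin]
  | cons x t => exact min_le_left _ _

theorem splitMin_append_le (a b : ℤ) (p q : List ℤ) :
    splitMin a b (p ++ q) ≤ p.countP (a ≤ ·) + q.countP (· < b) := by
  induction p with
  | nil => simpa using splitMin_le_countP a b q
  | cons x t ih =>
    refine (min_le_right _ _).trans ?_
    rw [List.countP_cons]
    simp only [decide_eq_true_eq, List.append_eq]
    omega

theorem exists_splitMin_eq (a b : ℤ) (l : List ℤ) :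
    ∃ p q, l = p ++ q ∧ splitMin a b l = p.countP (a ≤ ·) + q.countP (· < b) := by
  induction l with
  | nil => exact ⟨[], [], rfl, rfl⟩
  | cons x t ih =>
    obtain ⟨p, q, rfl, h⟩ := ih
    rcases min_choice ((x :: (p ++ q)).countP (· < b))
      ((if a ≤ x then 1 else 0) + splitMin a b (p ++ q)) with h' | h'
    · exact ⟨[], x :: (p ++ q), rfl, by rw [splitMin, h']; simp⟩
    · refine ⟨x :: p, q, rfl, ?_⟩
      rw [splitMin, h', h, List.countP_cons]
      simp only [decide_eq_true_eq]
      omega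

theorem splitMin_append_congr {a b : ℤ} {q q' : List ℤ} (hq : q.Perm q')
    (h : splitMin a b q = splitMin a b q') (p : List ℤ) :
    splitMin a b (p ++ q) = splitMin a b (p ++ q') := by
  induction p with
  | nil => exact h
  | cons x t ih =>
    simp only [List.cons_append, splitMin, ih]
    rw [((hq.append_left t).cons x).countP_eq]

/-- In each of the blocks `cab`, `bca`, `cba`, a cut strictly inside never beats the better of the
cuts just before and just after the block, and these two see the block only as a set of letters. -/
theorem splitMin_cab_bca {a b c : ℤ} (hab : a < b) (hbc : b < c) (A B : ℤ) (p q : List ℤ) :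
    splitMin A B (p ++ [c, a, b] ++ q) = splitMin A B (p ++ [b, c, a] ++ q) := by
  rw [List.append_assoc, List.append_assoc]
  refine splitMin_append_congr ?_ ?_ p
  · refine List.Perm.append_right q ?_
    exact (List.perm_append_comm (l₁ := [c, a]) (l₂ := [b]))
  · have := splitMin_le_countP A B q
    simp only [List.cons_append, List.nil_append, splitMin, List.countP_cons, decide_eq_true_eq]
    split_ifs <;> omega

theorem splitMin_cab_cba {a b c : ℤ} (hab : a < b) (hbc : b < c) (A B : ℤ) (p q : List ℤ) :
    splitMin A B (p ++ [c, a, b] ++ q) = splitMin A B (p ++ [c, b, a] ++ q) := by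
  rw [List.append_assoc, List.append_assoc]
  refine splitMin_append_congr ?_ ?_ p
  · exact List.Perm.append_right q ((List.Perm.swap b a []).cons c)
  · have := splitMin_le_countP A B q
    simp only [List.cons_append, List.nil_append, splitMin, List.countP_cons, decide_eq_true_eq]
    split_ifs <;> omega

theorem countP_le_add_countP_lt (a : ℤ) (l : List ℤ) :
    l.countP (a ≤ ·) + l.countP (· < a) = l.length := by
  induction l with
  | nil => rfl
  | cons x t ih =>
    simp only [List.countP_cons, decide_eq_true_eq, List.length_cons]
    split_ifs <;> omega

/-- For a fixed cut, both sides plus the same constant depend symmetrically on `a` and `b`, because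
`p` has as many letters as those `≥ a` and those `< a` together. -/
theorem splitMin_add_countP_le (a b : ℤ) (l : List ℤ) :
    splitMin a b l + l.countP (· < a) ≤ splitMin b a l + l.countP (· < b) := by
  obtain ⟨p, q, rfl, h⟩ := exists_splitMin_eq b a l
  have h1 := splitMin_append_le a b p q
  have h2 := countP_le_add_countP_lt a p
  have h3 := countP_le_add_countP_lt b p
  rw [h, List.countP_append, List.countP_append]
  omega

theorem splitMin_comm (a b : ℤ) (l : List ℤ) :
    splitMin a b l + l.countP (· < a) = splitMin b a l + l.countP (· < b) :=
  le_antisymm (splitMin_add_countP_le a b l) (splitMin_add_countP_le b a l)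

theorem splitMin_of_forall_le_left {a b : ℤ} {l : List ℤ} (h : ∀ u ∈ l, a ≤ u) :
    splitMin a b l = l.countP (· < b) := by
  induction l with
  | nil => rfl
  | cons x t ih =>
    rw [splitMin, ih fun u hu => h u (by simp [hu]), if_pos (h x (by simp)), List.countP_cons]
    split_ifs <;> omega

theorem splitMin_of_forall_le_right {a b : ℤ} {l : List ℤ} (h : ∀ u ∈ l, b ≤ u) :
    splitMin a b l = 0 := by
  have h1 := splitMin_le_countP a b l
  have h2 : l.countP (· < b) = 0 := by
    rw [List.countP_eq_zero]
    intro u hu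
    simpa using h u hu
  omega

/-- A letter below both thresholds is free on the left of the cut, so a cut before it is never
needed. -/
theorem splitMin_cons_min {a b x : ℤ} {t : List ℤ} (ha : x < a) (hb : x < b) :
    splitMin a b (x :: t) = splitMin a b t := by
  have := splitMin_le_countP a b t
  rw [splitMin, if_neg (by omega), List.countP_cons, if_pos (by simpa using hb)]
  omega

theorem splitMin_cons_cons_min {a b x y : ℤ} {t : List ℤ} (ha : y < a) (hb : y < b) :
    splitMin a b (x :: y :: t) = (if a ≤ x then 1 else 0) + splitMin a b t := by
  have := splitMin_le_countP a b t
  rw [splitMin, splitMin_cons_min ha hb, List.countP_cons, List.countP_cons,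
    if_pos (by simpa using hb)]
  simp only [decide_eq_true_eq]
  split_ifs <;> omega

end SplitMin

/-! ### The order-reversing symmetry of words -/

section NegRev

/-- The word obtained by reversing a word and negating its letters. -/
def negRev (l : List ℤ) : List ℤ := (l.map fun x => -x).reverse

theorem negRev_append (p q : List ℤ) : negRev (p ++ q) = negRev q ++ negRev p := by
  simp [negRev]

theorem negRev_negRev (l : List ℤ) : negRev (negRev l) = l := by
  simp [negRev]

/-- `cab` becomes `-b, -a, -c`, a pattern `bca` since `-c < -b < -a`. This symmetry later turns
minima into maxima. -/
theorem CoverA.negRev {v w : List ℤ} (h : CoverA v w) : CoverA (negRev w) (negRev v) := by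
  obtain ⟨p, q, a, b, c, hab, hbc, rfl, rfl⟩ := h
  refine ⟨SignedAtoms.negRev q, SignedAtoms.negRev p, -c, -b, -a, by omega, by omega, ?_, ?_⟩ <;>
    simp [SignedAtoms.negRev]

end NegRev

/-! ### The relations `<_A`, `≤_A`, `∼_A` -/

section Order

theorem CoverA.perm {v w : List ℤ} (h : CoverA v w) : v.Perm w := by
  obtain ⟨p, q, a, b, c, -, -, rfl, rfl⟩ := h
  exact ((List.perm_append_comm (l₁ := [c, a]) (l₂ := [b])).append_left p).append_right q

theorem CoverA.splitMin_eq {v w : List ℤ} (h : CoverA v w) (a b : ℤ) :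
    splitMin a b v = splitMin a b w := by
  obtain ⟨p, q, x, y, z, hxy, hyz, rfl, rfl⟩ := h
  exact splitMin_cab_bca hxy hyz a b p q

/-- `∼_A` is the equivalence relation generated by the covering relation. -/
theorem simA_iff {v w : List ℤ} : SimA v w ↔ Relation.EqvGen CoverA v w := by
  constructor
  · intro h
    induction h with
    | rel x y h =>
      induction h with
      | single h => exact .rel _ _ h
      | tail _ h ih => exact ih.trans _ _ _ (.rel _ _ h)
    | refl x => exact .refl x
    | symm x y _ ih => exact ih.symm
    | trans x y z _ _ h1 h2 => exact h1.trans _ _ _ h2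
  · intro h
    exact Relation.EqvGen.mono (fun _ _ h => Relation.TransGen.single h) _ _ h

theorem SimA.refl (v : List ℤ) : SimA v v := Relation.EqvGen.refl v

theorem SimA.symm {v w : List ℤ} (h : SimA v w) : SimA w v := Relation.EqvGen.symm _ _ h

theorem SimA.trans {u v w : List ℤ} (h : SimA u v) (h' : SimA v w) : SimA u w :=
  Relation.EqvGen.trans _ _ _ h h'

theorem LtA.simA {v w : List ℤ} (h : LtA v w) : SimA v w := Relation.EqvGen.rel _ _ h

theorem LeA.simA {v w : List ℤ} (h : LeA v w) : SimA v w := by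
  rcases h with rfl | h
  · exact .refl v
  · exact h.simA

/-- A function that is constant along covers is constant on the classes of `∼_A`. -/
theorem SimA.lift_eq {β : Type*} {f : List ℤ → β} (hf : ∀ v w, CoverA v w → f v = f w)
    {v w : List ℤ} (h : SimA v w) : f v = f w := by
  rw [simA_iff] at h
  induction h with
  | rel x y h => exact hf x y h
  | refl x => rfl
  | symm x y _ ih => exact ih.symm
  | trans x y z _ _ h1 h2 => exact h1.trans h2

theorem SimA.perm {v w : List ℤ} (h : SimA v w) : v.Perm w := by
  rw [simA_iff] at h
  induction h with
  | rel x y h => exact h.perm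
  | refl x => rfl
  | symm x y _ ih => exact ih.symm
  | trans x y z _ _ h1 h2 => exact h1.trans h2

theorem SimA.splitMin_eq {v w : List ℤ} (h : SimA v w) (a b : ℤ) :
    splitMin a b v = splitMin a b w :=
  h.lift_eq fun _ _ hc => hc.splitMin_eq a b

theorem LtA.negRev {v w : List ℤ} (h : LtA v w) : LtA (negRev w) (negRev v) := by
  induction h with
  | single h => exact .single h.negRev
  | tail _ h ih => exact .head h.negRev ih

theorem LeA.negRev {v w : List ℤ} (h : LeA v w) : LeA (negRev w) (negRev v) := by
  rcases h with rfl | h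
  · exact .inl rfl
  · exact .inr h.negRev

theorem SimA.negRev {v w : List ℤ} (h : SimA v w) : SimA (negRev v) (negRev w) := by
  rw [simA_iff] at h ⊢
  induction h with
  | rel x y h => exact .symm _ _ (.rel _ _ h.negRev)
  | refl x => exact .refl _
  | symm x y _ ih => exact ih.symm
  | trans x y z _ _ h1 h2 => exact h1.trans _ _ _ h2

/-- The sum of the larger entries of all inversions of a word. -/
def inversionSum : List ℤ → ℤ
  | [] => 0
  | x :: t => x * t.countP (· < x) + inversionSum t

/-- The inversions inside `cab` contribute `2c`, those inside `bca` contribute `b + c`. The weights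
matter: the plain number of inversions is constant along covers. -/
theorem CoverA.inversionSum_lt {v w : List ℤ} (h : CoverA v w) :
    inversionSum w < inversionSum v := by
  have hp := h.perm
  obtain ⟨p, q, a, b, c, hab, hbc, rfl, rfl⟩ := h
  induction p with
  | nil =>
    simp only [List.nil_append, List.cons_append, inversionSum, List.countP_cons,
      decide_eq_true_eq, if_pos hab, if_pos hbc, if_pos (hab.trans hbc), if_neg hab.not_gt,
      if_neg hbc.not_gt]
    push_cast
    linarith
  | cons x t ih =>
    have hp' := (List.perm_cons x).1 hp
    have h1 := ih hp'
    have h2 := hp'.countP_eq (· < x)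
    simp only [List.cons_append, List.append_eq, inversionSum] at h1 h2 ⊢
    rw [h2]
    linarith

theorem LtA.inversionSum_lt {v w : List ℤ} (h : LtA v w) : inversionSum w < inversionSum v := by
  induction h with
  | single h => exact h.inversionSum_lt
  | tail _ h ih => exact h.inversionSum_lt.trans ih

theorem LtA.irrefl (v : List ℤ) : ¬ LtA v v := fun h => lt_irrefl _ h.inversionSum_lt

theorem LtA.trans {u v w : List ℤ} (h : LtA u v) (h' : LtA v w) : LtA u w :=
  Relation.TransGen.trans h h'

theorem LeA.antisymm {v w : List ℤ} (h : LeA v w) (h' : LeA w v) : v = w := by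
  rcases h with h | h
  · exact h
  · rcases h' with h' | h'
    · exact h'.symm
    · exact absurd (h.trans h') (LtA.irrefl v)

end Order

/-! ### Bottom words are determined by `splitMin` -/

section Bottom

/-- No last letter of three consecutive letters is the least of them. -/
def IsBottom (l : List ℤ) : Prop :=
  ∀ (p q : List ℤ) (x y z : ℤ), l = p ++ [x, y, z] ++ q → ¬ (z < x ∧ z < y)

theorem IsBottom.tail {x : ℤ} {t : List ℤ} (h : IsBottom (x :: t)) : IsBottom t := by
  intro p q a b c e
  exact h (x :: p) q a b c (by simp [e])

/-- The least letter must be first or second: if the tail has its least letter in second place and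
this is also below `x`, the first three letters violate the condition. -/
theorem IsBottom.head_cases {x : ℤ} {t : List ℤ} (h : IsBottom (x :: t)) (hd : (x :: t).Nodup) :
    (∀ u ∈ t, x < u) ∨ ∃ y t', t = y :: t' ∧ y < x ∧ ∀ u ∈ t', y < u := by
  induction t generalizing x with
  | nil => simp
  | cons y t ih =>
    have hxy : x ≠ y := by
      rintro rfl
      simp at hd
    rcases ih h.tail hd.of_cons with h1 | ⟨z, t', rfl, hz, h1⟩
    · rcases lt_or_gt_of_ne hxy with h2 | h2
      · left
        intro u hu
        rcases List.mem_cons.1 hu with rfl | hu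
        · exact h2
        · exact h2.trans (h1 u hu)
      · exact .inr ⟨y, t, rfl, h2, h1⟩
    · have h3 := h [] t' x y z rfl
      have hxz : x ≠ z := by
        rintro rfl
        simp at hd
      have h4 : x < z := by omega
      left
      intro u hu
      simp only [List.mem_cons] at hu
      rcases hu with rfl | rfl | hu
      · omega
      · exact h4
      · exact h4.trans (h1 u hu)

theorem splitMin_eq_of_gt {m : ℤ} {t t' : List ℤ} (ht : ∀ u ∈ t, m < u) (hp : t.Perm t')
    (h : ∀ a b, m < a → m < b → splitMin a b t = splitMin a b t') (a b : ℤ) :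
    splitMin a b t = splitMin a b t' := by
  have ht' : ∀ u ∈ t', m < u := fun u hu => ht u (hp.mem_iff.2 hu)
  by_cases ha : m < a
  · by_cases hb : m < b
    · exact h a b ha hb
    · rw [splitMin_of_forall_le_right fun u hu => ?_, splitMin_of_forall_le_right fun u hu => ?_]
      · have := ht' u hu
        omega
      · have := ht u hu
        omega
  · rw [splitMin_of_forall_le_left fun u hu => ?_, splitMin_of_forall_le_left fun u hu => ?_,
      hp.countP_eq]
    · have := ht' u hu
      omega
    · have := ht u hu
      omega

theorem splitMin_ne_of_head_cases {x x' y : ℤ} {t t' : List ℤ} (ht : ∀ u ∈ t, x < u)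
    (hx : y < x') (ht' : ∀ u ∈ t', y < u) (hp : (x :: t).Perm (x' :: y :: t')) :
    ∃ a b, splitMin a b (x :: t) ≠ splitMin a b (x' :: y :: t') := by
  have e : x = y := by
    have h1 : x ∈ x' :: y :: t' := hp.mem_iff.1 (by simp)
    have h2 : y ∈ x :: t := hp.mem_iff.2 (by simp)
    simp only [List.mem_cons] at h1 h2
    rcases h2 with h2 | h2
    · exact h2.symm
    · have := ht y h2
      rcases h1 with h1 | h1 | h1
      · omega
      · omega
      · have := ht' x h1
        omega
  subst e
  -- With `b = x + 1` only the least letter is below `b`. It costs nothing when it comes first,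
  -- while in the other word the preceding letter `x' ≥ a` makes the cost 1.
  refine ⟨x', x + 1, ?_⟩
  rw [splitMin_cons_min hx (by omega), splitMin_cons_cons_min hx (by omega), if_pos le_rfl,
    splitMin_of_forall_le_right fun u hu => by have := ht u hu; omega]
  omega

/-- Among the rearrangements of a word, a word `l` with `IsBottom l` is determined
by `splitMin`. -/
theorem IsBottom.eq_of_splitMin_eq {l l' : List ℤ} (hl : IsBottom l) (hl' : IsBottom l')
    (hd : l.Nodup) (hp : l.Perm l') (h : ∀ a b, splitMin a b l = splitMin a b l') : l = l' := by
  induction hn : l.length using Nat.strong_induction_on generalizing l l' with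
  | _ n ih =>
  subst hn
  have hd' := hp.nodup_iff.1 hd
  match l, l', hp with
  | [], l', hp => exact (List.nil_perm.1 hp).symm
  | x :: t, [], hp => simp at hp
  | x :: t, x' :: t', hp =>
    rcases hl.head_cases hd with h1 | ⟨y, q, rfl, hy, h1⟩ <;>
      rcases hl'.head_cases hd' with h1' | ⟨y', q', rfl, hy', h1'⟩
    · have e : x = x' := by
        have h2 : x ∈ x' :: t' := hp.mem_iff.1 (by simp)
        have h3 : x' ∈ x :: t := hp.mem_iff.2 (by simp)
        rcases List.mem_cons.1 h2 with h2 | h2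
        · exact h2
        · rcases List.mem_cons.1 h3 with h3 | h3
          · exact h3.symm
          · have := h1 _ h3
            have := h1' _ h2
            omega
      subst e
      have hp' := (List.perm_cons x).1 hp
      rw [ih t.length (by simp) hl.tail hl'.tail hd.of_cons hp' ?_ rfl]
      refine splitMin_eq_of_gt h1 hp' fun a b ha hb => ?_
      rw [← splitMin_cons_min ha hb, h, splitMin_cons_min ha hb]
    · obtain ⟨a, b, hab⟩ := splitMin_ne_of_head_cases h1 hy' h1' hp
      exact absurd (h a b) hab
    · obtain ⟨a, b, hab⟩ := splitMin_ne_of_head_cases h1' hy h1 hp.symm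
      exact absurd (h a b).symm hab
    · have e : y = y' := by
        have h2 : y ∈ x' :: y' :: q' := hp.mem_iff.1 (by simp)
        have h3 : y' ∈ x :: y :: q := hp.mem_iff.2 (by simp)
        simp only [List.mem_cons] at h2 h3
        by_contra hne
        have h4 : y' < y := by
          rcases h2 with h2 | h2 | h2
          · omega
          · omega
          · exact h1' _ h2
        have h5 : y < y' := by
          rcases h3 with h3 | h3 | h3
          · omega
          · omega
          · exact h1 _ h3
        omega
      subst e
      have hb : y < y + 1 := by omega
      -- At `b = y + 1` nothing after the least letter `y` contributes, so `splitMin` only records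
      -- whether the first letter is at least `a`.
      have key : ∀ a, y < a → (a ≤ x ↔ a ≤ x') := by
        intro a ha
        have h2 := h a (y + 1)
        rw [splitMin_cons_cons_min ha hb, splitMin_cons_cons_min ha hb,
          splitMin_of_forall_le_right fun u hu => by have := h1 u hu; omega,
          splitMin_of_forall_le_right fun u hu => by have := h1' u hu; omega] at h2
        split_ifs at h2 <;> omega
      have e : x = x' :=
        le_antisymm ((key x hy).1 le_rfl) ((key x' hy').2 le_rfl)
      subst e
      have hp' := (List.perm_cons y).1 ((List.perm_cons x).1 hp)
      rw [ih q.length (by simp) hl.tail.tail hl'.tail.tail hd.of_cons.of_cons hp' ?_ rfl]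
      refine splitMin_eq_of_gt h1 hp' fun a b ha hb => ?_
      have h2 := h a b
      rw [splitMin_cons_cons_min ha hb, splitMin_cons_cons_min ha hb] at h2
      omega

end Bottom

/-! ### Descent-free classes have a minimum and a maximum -/

section Classes

/-- No word equivalent to `v` contains consecutive letters `c b a` with `a < b < c`. -/
def IsDescentFree (v : List ℤ) : Prop :=
  ∀ (p q : List ℤ) (a b c : ℤ), a < b → b < c → ¬ SimA v (p ++ [c, b, a] ++ q)

theorem IsDescentFree.of_simA {v w : List ℤ} (h : IsDescentFree v) (hs : SimA v w) :
    IsDescentFree w :=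
  fun p q a b c hab hbc hw => h p q a b c hab hbc (hs.trans hw)

theorem IsDescentFree.negRev {v : List ℤ} (h : IsDescentFree v) : IsDescentFree (negRev v) := by
  intro p q a b c hab hbc hs
  refine h (SignedAtoms.negRev q) (SignedAtoms.negRev p) (-c) (-b) (-a) (by omega) (by omega) ?_
  have := hs.negRev
  rw [negRev_negRev] at this
  convert this using 1
  simp [SignedAtoms.negRev]

/-- Below every word there is one that covers no other word. -/
theorem exists_leA_minimal (v : List ℤ) : ∃ m, LeA m v ∧ ∀ m', ¬ CoverA m' m := by
  have hfin : {m | LeA m v}.Finite := by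
    refine (List.finite_toSet v.permutations).subset fun m hm => ?_
    exact List.mem_permutations.2 (LeA.simA hm).perm
  -- Going down in `<_A` increases `inversionSum`, so a maximizer among the finitely many
  -- rearrangements covers nothing.
  obtain ⟨m, hm, hmax⟩ := Set.exists_max_image _ inversionSum hfin ⟨v, .inl rfl⟩
  refine ⟨m, hm, fun m' h => ?_⟩
  have h1 : LeA m' v := by
    rcases hm with rfl | hm
    · exact .inr (.single h)
    · exact .inr (.head h hm)
  exact absurd h.inversionSum_lt (hmax m' h1).not_gt

theorem IsDescentFree.exists_isBottom {v : List ℤ} (h : IsDescentFree v) (hd : v.Nodup) :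
    ∃ m, LeA m v ∧ IsBottom m := by
  obtain ⟨m, hm, hmin⟩ := exists_leA_minimal v
  refine ⟨m, hm, ?_⟩
  rintro p q x y z rfl ⟨hzx, hzy⟩
  have hd' : (p ++ [x, y, z] ++ q).Nodup := hm.simA.perm.nodup_iff.2 hd
  have hxy : x ≠ y := by
    rintro rfl
    simp [List.nodup_append] at hd'
  -- Three letters ending in their least one form `bca`, excluded by minimality, or `cba`, excluded
  -- by descent-freeness.
  rcases lt_or_gt_of_ne hxy with h1 | h1
  · exact hmin _ ⟨p, q, z, x, y, hzx, h1, rfl, rfl⟩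
  · exact h p q z y x hzy h1 hm.simA.symm

/-- Two rearrangements of a word whose classes avoid consecutive letters `c b a` and that have the
same `splitMin` have a common lower bound under `≤_A`. -/
theorem IsDescentFree.simA_of_splitMin_eq {v w : List ℤ} (hv : IsDescentFree v)
    (hw : IsDescentFree w) (hd : v.Nodup) (hp : v.Perm w)
    (h : ∀ a b, splitMin a b v = splitMin a b w) : ∃ m, LeA m v ∧ LeA m w := by
  obtain ⟨m, hm, hmb⟩ := hv.exists_isBottom hd
  obtain ⟨m', hm', hmb'⟩ := hw.exists_isBottom (hp.nodup_iff.1 hd)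
  have e : m = m' := by
    refine hmb.eq_of_splitMin_eq hmb' (hm.simA.perm.nodup_iff.2 hd)
      (hm.simA.perm.trans (hp.trans hm'.simA.perm.symm)) fun a b => ?_
    rw [hm.simA.splitMin_eq, h, ← hm'.simA.splitMin_eq]
  subst e
  exact ⟨m, hm, hm'⟩

/-- A minimal word `m` has a common lower bound with each word of the class, and that bound can only
be `m`. -/
theorem IsDescentFree.exists_minimum {v : List ℤ} (hv : IsDescentFree v) (hd : v.Nodup) :
    ∃ m, SimA v m ∧ ∀ w, SimA v w → LeA m w := by
  obtain ⟨m, hm, hmin⟩ := exists_leA_minimal v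
  refine ⟨m, hm.simA.symm, fun w hw => ?_⟩
  have hmw := hm.simA.trans hw
  have hvm := hm.simA.symm
  obtain ⟨m', h1, h2⟩ := (hv.of_simA hvm).simA_of_splitMin_eq (hv.of_simA hw)
    (hvm.perm.nodup_iff.1 hd) hmw.perm hmw.splitMin_eq
  rcases h1 with rfl | h1
  · exact h2
  · obtain ⟨x, -, hx⟩ := Relation.TransGen.tail'_iff.1 h1
    exact absurd hx (hmin x)

theorem IsDescentFree.exists_maximum {v : List ℤ} (hv : IsDescentFree v) (hd : v.Nodup) :
    ∃ m, SimA v m ∧ ∀ w, SimA v w → LeA w m := by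
  have hd' : (SignedAtoms.negRev v).Nodup := by
    rw [SignedAtoms.negRev, List.nodup_reverse]
    exact hd.map neg_injective
  obtain ⟨m, hm, h⟩ := hv.negRev.exists_minimum hd'
  refine ⟨SignedAtoms.negRev m, ?_, fun w hw => ?_⟩
  · simpa [negRev_negRev] using hm.negRev
  · simpa [negRev_negRev] using (h _ hw.negRev).negRev

end Classes


/-! ### Permutations of `X` and their words -/

section Elements

variable {X : Finset ℤ}

/-- The increasing list of all elements of `X`. -/
noncomputable def elems (X : Finset ℤ) : List X := List.ofFn (X.orderIsoOfFin rfl)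

theorem elems_pairwise (X : Finset ℤ) : (elems X).Pairwise (· < ·) := by
  rw [elems, List.pairwise_ofFn]
  intro i j h
  exact (X.orderIsoOfFin rfl).strictMono h

theorem mem_elems (x : X) : x ∈ elems X := by
  rw [elems, List.mem_ofFn]
  exact ⟨(X.orderIsoOfFin rfl).symm x, by simp⟩

theorem elems_nodup (X : Finset ℤ) : (elems X).Nodup :=
  (elems_pairwise X).imp fun h => h.ne

theorem elems_map_perm (σ : Equiv.Perm X) : ((elems X).map σ).Perm (elems X) := by
  rw [List.perm_ext_iff_of_nodup ((elems_nodup X).map σ.injective) (elems_nodup X)]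
  intro x
  refine ⟨fun _ => mem_elems x, fun _ => ?_⟩
  exact List.mem_map.2 ⟨σ⁻¹ x, mem_elems _, by simp⟩

theorem oneLineA_eq_map (σ : Equiv.Perm X) :
    oneLineA σ = (elems X).map fun k => (σ k : ℤ) := by
  rw [elems, List.map_ofFn]
  rfl

theorem oneLineA_injective : Function.Injective (oneLineA (X := X)) := by
  intro σ τ h
  rw [oneLineA_eq_map, oneLineA_eq_map] at h
  ext k
  exact List.map_inj_left.1 h k (mem_elems k)

theorem oneLineA_nodup (σ : Equiv.Perm X) : (oneLineA σ).Nodup := by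
  rw [oneLineA_eq_map]
  exact (elems_nodup X).map (Subtype.val_injective.comp σ.injective)

theorem mem_oneLineA (σ : Equiv.Perm X) {a : ℤ} : a ∈ oneLineA σ ↔ a ∈ X := by
  rw [oneLineA_eq_map, List.mem_map]
  constructor
  · rintro ⟨k, -, rfl⟩
    exact (σ k).2
  · intro h
    exact ⟨σ⁻¹ ⟨a, h⟩, mem_elems _, by simp⟩

theorem exists_oneLineA_eq {l : List ℤ} (hd : l.Nodup) (hX : ∀ a, a ∈ l ↔ a ∈ X) :
    ∃ σ : Equiv.Perm X, oneLineA σ = l := by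
  have hp : l.Perm (X.sort (· ≤ ·)) :=
    (List.perm_ext_iff_of_nodup hd (X.sort_nodup _)).2 fun a => by simp [hX]
  have hl : l.length = X.card := by rw [hp.length_eq, Finset.length_sort]
  let f : X → X := fun x => ⟨l[(X.orderIsoOfFin rfl).symm x],
    (hX _).1 (List.getElem_mem _)⟩
  have hf : Function.Injective f := by
    intro x y h
    have h1 := (hd.getElem_inj_iff).1 (congrArg Subtype.val h)
    exact (X.orderIsoOfFin rfl).symm.injective (Fin.ext h1)
  refine ⟨Equiv.ofBijective f (Finite.injective_iff_bijective.1 hf), ?_⟩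
  refine List.ext_getElem (by simp [oneLineA, hl]) fun i h1 h2 => ?_
  simp [oneLineA, f]

theorem elems_eq_append_of_mem (x : X) :
    ∃ p q, elems X = p ++ x :: q ∧ (∀ k ∈ p, k < x) ∧ ∀ k ∈ q, x < k := by
  obtain ⟨p, q, h⟩ := List.append_of_mem (mem_elems x)
  have hs := elems_pairwise X
  rw [h, List.pairwise_append, List.pairwise_cons] at hs
  exact ⟨p, q, h, fun k hk => hs.2.2 k hk x (by simp), hs.2.1.1⟩

theorem elems_eq_append_of_covBy {x y : X} (hxy : x ⋖ y) :
    ∃ p q, elems X = p ++ [x, y] ++ q ∧ (∀ k ∈ p, k < x) ∧ ∀ k ∈ q, y < k := by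
  obtain ⟨p, t, h, hp, hq⟩ := elems_eq_append_of_mem x
  have hs := elems_pairwise X
  rw [h, List.pairwise_append, List.pairwise_cons] at hs
  have hy : y ∈ t := by
    have := mem_elems y
    rw [h, List.mem_append, List.mem_cons] at this
    rcases this with h1 | h1 | h1
    · exact absurd (hp y h1) hxy.lt.not_gt
    · exact absurd h1 hxy.lt.ne'
    · exact h1
  cases t with
  | nil => simp at hy
  | cons z q =>
    have hz := List.pairwise_cons.1 hs.2.1.2
    have e : z = y := by
      rcases List.mem_cons.1 hy with rfl | h1
      · rfl
      · exact absurd (hz.1 y h1) (hxy.2 (hq z (by simp)))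
    subst e
    exact ⟨p, q, by simp [h], hp, hz.1⟩

theorem oneLineA_mul_swap (σ : Equiv.Perm X) {x y : X} (hxy : x ⋖ y) :
    ∃ p q, oneLineA σ = p ++ [(σ x : ℤ), (σ y : ℤ)] ++ q ∧
      oneLineA (σ * Equiv.swap x y) = p ++ [(σ y : ℤ), (σ x : ℤ)] ++ q := by
  obtain ⟨p, q, h, hp, hq⟩ := elems_eq_append_of_covBy hxy
  refine ⟨p.map fun k => (σ k : ℤ), q.map fun k => (σ k : ℤ), ?_, ?_⟩
  · simp [oneLineA_eq_map, h]
  · rw [oneLineA_eq_map, h]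
    simp only [List.map_append, List.map_cons, List.map_nil, Equiv.Perm.mul_apply,
      Equiv.swap_apply_left, Equiv.swap_apply_right]
    congr 1
    · congr 1
      refine List.map_congr_left fun k hk => ?_
      rw [Equiv.swap_apply_of_ne_of_ne (hp k hk).ne ((hp k hk).trans hxy.lt).ne]
    · refine List.map_congr_left fun k hk => ?_
      rw [Equiv.swap_apply_of_ne_of_ne (hxy.lt.trans (hq k hk)).ne' (hq k hk).ne']

theorem exists_covBy_of_ne_one {σ : Equiv.Perm X} (h : σ ≠ 1) : ∃ x y, x ⋖ y ∧ σ y < σ x := by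
  by_contra! hc
  have hm : StrictMono σ := by
    let _ := Fintype.toLocallyFiniteOrder (α := X)
    exact (strictMono_iff_forall_covBy σ).2 fun x y hxy =>
      lt_of_le_of_ne (hc x y hxy) (σ.injective.ne hxy.lt.ne)
  apply h
  -- A finite chain has no nontrivial automorphism.
  have : hm.orderIsoOfSurjective σ σ.surjective = OrderIso.refl X := Subsingleton.elim _ _
  ext x
  exact congrArg Subtype.val (DFunLike.congr_fun this x)

end Elements

/-! ### Rank functions and sorting steps -/

section Rank

variable {X : Finset ℤ}

/-- The number of `k ∈ X` with `a ≤ k` and `σ k < b`. -/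
noncomputable def rank (σ : Equiv.Perm X) (a b : ℤ) : ℕ :=
  (elems X).countP fun k : X => a ≤ (k : ℤ) ∧ (σ k : ℤ) < b

theorem rank_congr {σ : Equiv.Perm X} {a a' : ℤ} (h : ∀ k : X, a ≤ (k : ℤ) ↔ a' ≤ (k : ℤ))
    (b : ℤ) : rank σ a b = rank σ a' b := by
  rw [rank, rank]
  congr 1
  funext k
  simp [h k]

theorem rank_coe (σ : Equiv.Perm X) (x : X) (b : ℤ) :
    rank σ x b = (if (σ x : ℤ) < b then 1 else 0) + rank σ (x + 1) b := by
  obtain ⟨p, q, e, hp, hq⟩ := elems_eq_append_of_mem x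
  have hp' : ∀ k ∈ p, (k : ℤ) < x := hp
  have hq' : ∀ k ∈ q, (x : ℤ) < k := hq
  rw [rank, rank, e]
  simp only [List.countP_append, List.countP_cons]
  have h1 : ∀ c : ℤ, (x : ℤ) ≤ c →
      p.countP (fun k : X => decide (c ≤ (k : ℤ) ∧ (σ k : ℤ) < b)) = 0 := by
    intro c hc
    rw [List.countP_eq_zero]
    intro k hk
    have := hp' k hk
    simp only [decide_eq_true_eq]
    omega
  rw [h1 _ le_rfl, h1 _ (by omega)]
  have h2 : q.countP (fun k : X => decide ((x : ℤ) ≤ (k : ℤ) ∧ (σ k : ℤ) < b)) =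
      q.countP (fun k : X => decide ((x : ℤ) + 1 ≤ (k : ℤ) ∧ (σ k : ℤ) < b)) := by
    refine List.countP_congr fun k hk => ?_
    have := hq' k hk
    simp only [decide_eq_true_eq]
    omega
  rw [h2]
  simp
  omega

/-- The jump of the rank function in `a` at `x` tells whether `σ x < b`; letting `b` vary recovers
`σ x`. -/
theorem rank_injective {σ τ : Equiv.Perm X} (h : ∀ a b, rank σ a b = rank τ a b) : σ = τ := by
  have key : ∀ x b, (σ x : ℤ) < b ↔ (τ x : ℤ) < b := by
    intro x b
    have h1 := h x b
    rw [rank_coe, rank_coe, h] at h1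
    split_ifs at h1 <;> omega
  ext x
  have h1 := key x (σ x + 1)
  have h2 := key x (τ x + 1)
  omega

theorem rank_one_self (a : ℤ) : rank (1 : Equiv.Perm X) a a = 0 := by
  rw [rank, List.countP_eq_zero]
  intro k _ h
  exact (of_decide_eq_true h).1.not_gt (of_decide_eq_true h).2

theorem rank_le_add (σ : Equiv.Perm X) (a b l : ℤ) :
    rank σ a b ≤ rank (1 : Equiv.Perm X) a l + rank σ l b := by
  rw [rank, rank, rank]
  have key : ∀ t : List X, t.countP (fun k : X => decide (a ≤ (k : ℤ) ∧ (σ k : ℤ) < b)) ≤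
      t.countP (fun k : X => decide (a ≤ (k : ℤ) ∧ (k : ℤ) < l)) +
        t.countP (fun k : X => decide (l ≤ (k : ℤ) ∧ (σ k : ℤ) < b)) := by
    intro t
    induction t with
    | nil => simp
    | cons k t ih =>
      simp only [List.countP_cons, decide_eq_true_eq]
      split_ifs <;> omega
  exact key _

theorem rank_inv (σ : Equiv.Perm X) (a b : ℤ) :
    rank σ⁻¹ a b = (elems X).countP fun k : X => (k : ℤ) < b ∧ a ≤ (σ k : ℤ) := by
  rw [rank, ← (elems_map_perm σ).countP_eq, List.countP_map]
  congr 1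
  funext k
  simp [Bool.and_comm]

theorem rank_mul_swap_of_iff (σ : Equiv.Perm X) {x y : X} {a : ℤ}
    (h : a ≤ (x : ℤ) ↔ a ≤ (y : ℤ)) (b : ℤ) :
    rank (σ * Equiv.swap x y) a b = rank σ a b := by
  rw [rank, rank, ← (elems_map_perm (Equiv.swap x y)).countP_eq, List.countP_map]
  congr 1
  funext k
  simp only [Function.comp, Equiv.Perm.mul_apply, Equiv.swap_apply_self, decide_eq_decide]
  rcases eq_or_ne k x with rfl | hx
  · simp [h]
  · rcases eq_or_ne k y with rfl | hy
    · simp [h]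
    · rw [Equiv.swap_apply_of_ne_of_ne hx hy]

theorem rank_of_covBy (σ : Equiv.Perm X) {x y : X} (hxy : x ⋖ y) {a : ℤ} (h1 : (x : ℤ) < a)
    (h2 : a ≤ y) (b : ℤ) :
    rank σ a b = (if (σ y : ℤ) < b then 1 else 0) + rank σ (y + 1) b := by
  rw [← rank_coe]
  refine rank_congr (fun k => ⟨fun hk => ?_, fun hk => h2.trans hk⟩) b
  have h3 : x < k := by
    rw [← Subtype.coe_lt_coe]
    omega
  exact not_lt.1 (hxy.2 h3)

theorem rank_left_of_covBy (σ : Equiv.Perm X) {x y : X} (hxy : x ⋖ y) (b : ℤ) :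
    rank σ x b = (if (σ x : ℤ) < b then 1 else 0) + ((if (σ y : ℤ) < b then 1 else 0) +
      rank σ (y + 1) b) := by
  have : (x : ℤ) < y := hxy.lt
  rw [rank_coe, rank_of_covBy σ hxy (a := x + 1) (by omega) (by omega)]

/-- The permutation `σ` or `σ * (x, y)`, whichever maps `x` to the larger value. -/
noncomputable def sortAt (σ : Equiv.Perm X) (x y : X) : Equiv.Perm X :=
  if σ x < σ y then σ * Equiv.swap x y else σ

theorem sortAt_of_lt {σ : Equiv.Perm X} {x y : X} (h : σ x < σ y) :
    sortAt σ x y = σ * Equiv.swap x y := if_pos h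

theorem sortAt_of_not_lt {σ : Equiv.Perm X} {x y : X} (h : ¬ σ x < σ y) : sortAt σ x y = σ :=
  if_neg h

/-- The operation on rank functions that corresponds to `sortAt`. -/
def rankStep (x y : ℤ) (f : ℤ → ℕ) (a : ℤ) : ℕ :=
  if x < a ∧ a ≤ y then min (f x) (f (y + 1) + 1) else f a

/-- Only thresholds between `x` and `y` notice the swap. There the count beyond `y` is increased by
1 exactly when the smaller of the two values is below `b`, which is the minimum of "count both" and
"count one". -/
theorem rank_sortAt (σ : Equiv.Perm X) {x y : X} (hxy : x ⋖ y) (a b : ℤ) :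
    rank (sortAt σ x y) a b = rankStep x y (fun c => rank σ c b) a := by
  have hlt : (x : ℤ) < y := hxy.lt
  by_cases ha : (x : ℤ) < a ∧ a ≤ y
  · rw [rankStep, if_pos ha, rank_left_of_covBy σ hxy, rank_of_covBy _ hxy ha.1 ha.2]
    by_cases h : σ x < σ y
    · have h' : (σ x : ℤ) < σ y := h
      rw [sortAt, if_pos h, rank_mul_swap_of_iff σ (by omega), Equiv.Perm.mul_apply,
        Equiv.swap_apply_right]
      split_ifs <;> omega
    · have h' : ¬ (σ x : ℤ) < σ y := h
      rw [sortAt, if_neg h]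
      split_ifs <;> omega
  · rw [rankStep, if_neg ha]
    by_cases h : σ x < σ y
    · rw [sortAt, if_pos h, rank_mul_swap_of_iff σ (by omega)]
    · rw [sortAt, if_neg h]

end Rank

/-! ### Inversion numbers -/

section Inversions

/-- The number of inversions of a word. -/
def inversions : List ℤ → ℕ
  | [] => 0
  | x :: t => t.countP (· < x) + inversions t

theorem inversions_swap {x y : ℤ} (h : x < y) (p q : List ℤ) :
    inversions (p ++ [y, x] ++ q) = inversions (p ++ [x, y] ++ q) + 1 := by
  induction p with
  | nil =>
    simp only [List.nil_append, List.cons_append, inversions, List.countP_cons,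
      decide_eq_true_eq, if_pos h, if_neg h.not_gt]
    omega
  | cons z t ih =>
    have hp : (t ++ [y, x] ++ q).Perm (t ++ [x, y] ++ q) :=
      ((List.Perm.swap x y []).append_left t).append_right q
    have h2 := hp.countP_eq (· < z)
    simp only [List.cons_append, inversions] at ih h2 ⊢
    rw [h2, ih]
    omega

theorem inversions_eq_zero {l : List ℤ} (h : l.Pairwise (· < ·)) : inversions l = 0 := by
  induction l with
  | nil => rfl
  | cons x t ih =>
    rw [List.pairwise_cons] at h
    rw [inversions, ih h.2, List.countP_eq_zero.2]
    intro a ha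
    simpa using (h.1 a ha).le

theorem CoverA.inversions_eq {v w : List ℤ} (h : CoverA v w) : inversions v = inversions w := by
  obtain ⟨p, q, a, b, c, hab, hbc, rfl, rfl⟩ := h
  -- Both blocks lie two adjacent swaps above `abc`: `cab` through `acb`, and `bca` through `bac`.
  have h1 := inversions_swap hbc (p ++ [a]) q
  have h2 := inversions_swap hab p (c :: q)
  have h3 := inversions_swap (hab.trans hbc) p (b :: q)
  have h4 := inversions_swap (hab.trans hbc) (p ++ [b]) q
  simp only [List.append_assoc, List.cons_append, List.nil_append] at *
  omega

theorem inversions_cba {a b c : ℤ} (hab : a < b) (p q : List ℤ) :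
    inversions (p ++ [c, b, a] ++ q) = inversions (p ++ [c, a, b] ++ q) + 1 := by
  have h := inversions_swap hab (p ++ [c]) q
  simpa using h

theorem SimA.inversions_eq {v w : List ℤ} (h : SimA v w) : inversions v = inversions w :=
  h.lift_eq fun _ _ hc => hc.inversions_eq

variable {X : Finset ℤ}

theorem inversions_mul_swap (σ : Equiv.Perm X) {x y : X} (hxy : x ⋖ y) (h : σ x < σ y) :
    inversions (oneLineA (σ * Equiv.swap x y)) = inversions (oneLineA σ) + 1 := by
  obtain ⟨p, q, h1, h2⟩ := oneLineA_mul_swap σ hxy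
  rw [h1, h2, inversions_swap h]

theorem inversions_mul_swap' (σ : Equiv.Perm X) {x y : X} (hxy : x ⋖ y) (h : σ y < σ x) :
    inversions (oneLineA (σ * Equiv.swap x y)) + 1 = inversions (oneLineA σ) := by
  obtain ⟨p, q, h1, h2⟩ := oneLineA_mul_swap σ hxy
  rw [h1, h2, inversions_swap h]

theorem inversions_one : inversions (oneLineA (1 : Equiv.Perm X)) = 0 := by
  refine inversions_eq_zero ?_
  rw [oneLineA_eq_map, List.pairwise_map]
  exact (elems_pairwise X).imp fun h => h

end Inversions


/-! ### Length and reduced words in a group with generators -/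

section Length

variable {G : Type*} [Group G] {S : Set G}

theorem length_le_of_isWordFor {l : List G} {g : G} (h : IsWordFor S l g) :
    length S g ≤ l.length :=
  Nat.sInf_le ⟨l, h, rfl⟩

theorem exists_isReducedWord {g : G} (h : ∃ l, IsWordFor S l g) : ∃ l, IsReducedWord S l g := by
  obtain ⟨l, hl⟩ := h
  obtain ⟨l', h1, h2⟩ := Nat.sInf_mem
    (s := {k : ℕ | ∃ l : List G, IsWordFor S l g ∧ l.length = k}) ⟨_, l, hl, rfl⟩
  exact ⟨l', h1, h2⟩

theorem IsWordFor.append {l l' : List G} {g g' : G} (h : IsWordFor S l g)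
    (h' : IsWordFor S l' g') : IsWordFor S (l ++ l') (g * g') := by
  refine ⟨fun s hs => ?_, by rw [List.prod_append, h.2, h'.2]⟩
  rcases List.mem_append.1 hs with hs | hs
  · exact h.1 s hs
  · exact h'.1 s hs

theorem IsWordFor.inv (hS : ∀ s ∈ S, s⁻¹ ∈ S) {l : List G} {g : G} (h : IsWordFor S l g) :
    IsWordFor S (l.map fun s => s⁻¹).reverse g⁻¹ := by
  refine ⟨fun s hs => ?_, by rw [← List.prod_inv_reverse, h.2]⟩
  simp only [List.mem_reverse, List.mem_map] at hs
  obtain ⟨t, ht, rfl⟩ := hs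
  exact hS t (h.1 t ht)

theorem length_inv (hS : ∀ s ∈ S, s⁻¹ ∈ S) (g : G) : length S g⁻¹ = length S g := by
  unfold length
  congr 1
  ext k
  constructor
  · rintro ⟨l, hl, rfl⟩
    exact ⟨_, by simpa using hl.inv hS, by simp⟩
  · rintro ⟨l, hl, rfl⟩
    exact ⟨_, hl.inv hS, by simp⟩

/-- A multiple `L` of the length function is recognized by its behaviour under multiplication with
the generators. -/
theorem mul_length_eq {k : ℕ} (hk : 0 < k) {L : G → ℕ} (h1 : L 1 = 0)
    (hS : ∀ s ∈ S, s * s = 1) (hup : ∀ g, ∀ s ∈ S, L (g * s) ≤ L g + k)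
    (hdown : ∀ g, g ≠ 1 → ∃ s ∈ S, L (g * s) + k = L g) (g : G) :
    (∃ l, IsWordFor S l g) ∧ k * length S g = L g := by
  have hex : ∀ n, ∀ g, L g = n → ∃ l, IsWordFor S l g ∧ k * l.length = L g := by
    intro n
    induction n using Nat.strong_induction_on with
    | _ n ih =>
      rintro g rfl
      by_cases hg : g = 1
      · subst hg
        exact ⟨[], ⟨by simp, rfl⟩, by simp [h1]⟩
      · obtain ⟨s, hs, hL⟩ := hdown g hg
        obtain ⟨l, hl, hlen⟩ := ih (L (g * s)) (by omega) (g * s) rfl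
        have hw := hl.append (l' := [s]) (g' := s) ⟨by simpa using hs, by simp⟩
        rw [mul_assoc, hS s hs, mul_one] at hw
        refine ⟨_, hw, ?_⟩
        rw [List.length_append, List.length_singleton, mul_add, hlen]
        omega
  have hle : ∀ l : List G, (∀ s ∈ l, s ∈ S) → L l.prod ≤ k * l.length := by
    intro l
    induction l using List.reverseRecOn with
    | nil => simp [h1]
    | append_singleton l s ih =>
      intro h
      have h2 := ih fun t ht => h t (by simp [ht])
      have h3 := hup l.prod s (h s (by simp))
      rw [List.prod_append, List.prod_singleton, List.length_append, List.length_singleton,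
        mul_add]
      omega
  obtain ⟨l, hl, hlen⟩ := hex _ g rfl
  refine ⟨⟨l, hl⟩, le_antisymm ?_ ?_⟩
  · rw [← hlen]
    exact Nat.mul_le_mul_left k (length_le_of_isWordFor hl)
  · obtain ⟨l', hl', hlen'⟩ := exists_isReducedWord ⟨l, hl⟩
    rw [← hlen', ← hl'.2]
    exact hle l' hl'.1

/-- Prefixes of a reduced word are reduced, so each Demazure step along it is a genuine
multiplication. -/
theorem foldl_demazureStep_of_isReducedWord {l : List G} {g : G} (h : IsReducedWord S l g) :
    l.foldl (demazureStep S) 1 = g := by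
  induction l using List.reverseRecOn generalizing g with
  | nil => simpa using h.1.2
  | append_singleton l s ih =>
    have hl : IsWordFor S l l.prod := ⟨fun t ht => h.1.1 t (by simp [ht]), rfl⟩
    have hs : IsWordFor S [s] s := ⟨fun t ht => h.1.1 t (by simp_all), by simp⟩
    have hg : l.prod * s = g := by rw [← h.1.2]; simp
    have hlen := h.2
    rw [List.length_append, List.length_singleton] at hlen
    obtain ⟨l', hl', hlen'⟩ := exists_isReducedWord ⟨l, hl⟩
    have h1 := length_le_of_isWordFor (hl'.append hs)
    rw [hg, List.length_append, List.length_singleton] at h1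
    have h2 := length_le_of_isWordFor hl
    have hred : IsReducedWord S l l.prod := ⟨hl, by omega⟩
    rw [List.foldl_append, ih hred, List.foldl_cons, List.foldl_nil, demazureStep,
      if_pos (by rw [hg]; omega), hg]

end Length

/-! ### Demazure products as min-plus products -/

section MinPlus

/-- `F` is the min-plus product of the matrix `M` and the vector `U`. -/
def IsMinPlus (F : ℤ → ℕ) (M : ℤ → ℤ → ℕ) (U : ℤ → ℕ) : Prop :=
  ∀ a, (∀ l, F a ≤ M a l + U l) ∧ ∃ l, F a = M a l + U l

theorem IsMinPlus.rankStep (x y : ℤ) {F : ℤ → ℕ} {M : ℤ → ℤ → ℕ} {U : ℤ → ℕ}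
    (h : IsMinPlus F M U) :
    IsMinPlus (rankStep x y F) (fun a l => rankStep x y (fun c => M c l) a) U := by
  intro a
  simp only [SignedAtoms.rankStep]
  split_ifs with ha
  · obtain ⟨h1, l1, h2⟩ := h x
    obtain ⟨h3, l2, h4⟩ := h (y + 1)
    refine ⟨fun l => ?_, ?_⟩
    · have := h1 l
      have := h3 l
      omega
    -- The minimum is attained at the optimal index of whichever row, `x` or `y + 1`, gives the
    -- smaller term.
    · by_cases hc : F x ≤ F (y + 1) + 1
      · refine ⟨l1, ?_⟩
        have := h3 l1
        omega
      · refine ⟨l2, ?_⟩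
        have := h1 l2
        omega
  · exact h a

variable {G : Type*} [Group G] {S : Set G} {X : Finset ℤ}

/-- A Demazure product with a simple generator acts on rank functions by an operation that commutes
with min-plus products. -/
def HasRankSteps (S : Set G) (φ : G →* Equiv.Perm X) : Prop :=
  ∀ s ∈ S, ∃ T : (ℤ → ℕ) → ℤ → ℕ,
    (∀ F M U, IsMinPlus F M U → IsMinPlus (T F) (fun a l => T (fun c => M c l) a) U) ∧
    ∀ u a b, rank (φ (demazureStep S u s)) a b = T (fun c => rank (φ u) c b) a

/-- The rank function of the identity acts as a unit on rank functions, and each further step acts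
on the row index only, hence passes through the product. -/
theorem HasRankSteps.foldl {φ : G →* Equiv.Perm X} (h : HasRankSteps S φ) (u : G) (b : ℤ)
    {l : List G} (hl : ∀ s ∈ l, s ∈ S) :
    IsMinPlus (fun a => rank (φ (l.foldl (demazureStep S) u)) a b)
      (rank (φ (l.foldl (demazureStep S) 1))) (fun a => rank (φ u) a b) := by
  induction l using List.reverseRecOn with
  | nil =>
    intro a
    simp only [List.foldl_nil, map_one]
    exact ⟨fun l => rank_le_add _ a b l, a, by rw [rank_one_self, zero_add]⟩
  | append_singleton l s ih =>
    obtain ⟨T, hT, hs⟩ := h s (hl s (by simp))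
    have := hT _ _ _ (ih fun t ht => hl t (by simp [ht]))
    simp only [List.foldl_append, List.foldl_cons, List.foldl_nil]
    convert this using 1
    · funext a
      rw [hs]
    · funext a c
      rw [hs]

/-- The rank function of a Demazure product is the min-plus product of the rank functions. -/
theorem HasRankSteps.rank_demazure {φ : G →* Equiv.Perm X} (h : HasRankSteps S φ) (u : G) {v : G}
    (hv : ∃ l, IsWordFor S l v) (b : ℤ) :
    IsMinPlus (fun a => rank (φ (demazure S u v)) a b) (rank (φ v)) (fun a => rank (φ u) a b) := by
  have hex := exists_isReducedWord hv
  have hred := hex.choose_spec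
  have := h.foldl u b hred.1.1
  rw [foldl_demazureStep_of_isReducedWord hred] at this
  rwa [demazure, dif_pos hex]

theorem exists_threshold {l p q : List X} (hl : l.Pairwise (· < ·)) (h : l = p ++ q) :
    ∃ c : ℤ, (∀ k ∈ p, (k : ℤ) < c) ∧ ∀ k ∈ q, c ≤ (k : ℤ) := by
  subst h
  rw [List.pairwise_append] at hl
  cases q with
  | nil =>
    obtain ⟨M, hM⟩ := X.bddAbove
    exact ⟨M + 1, fun k _ => by have := hM k.2; omega, by simp⟩
  | cons x q =>
    refine ⟨x, fun k hk => hl.2.2 k hk x (by simp), fun k hk => ?_⟩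
    rcases List.mem_cons.1 hk with rfl | hk
    · exact le_rfl
    · exact ((List.pairwise_cons.1 hl.2.1).1 k hk).le

theorem exists_split_at {l : List X} (hl : l.Pairwise (· < ·)) (c : ℤ) :
    ∃ p q, l = p ++ q ∧ (∀ k ∈ p, (k : ℤ) < c) ∧ ∀ k ∈ q, c ≤ (k : ℤ) := by
  induction l with
  | nil => exact ⟨[], [], by simp⟩
  | cons x t ih =>
    rw [List.pairwise_cons] at hl
    by_cases hx : (x : ℤ) < c
    · obtain ⟨p, q, rfl, h1, h2⟩ := ih hl.2
      refine ⟨x :: p, q, rfl, fun k hk => ?_, h2⟩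
      rcases List.mem_cons.1 hk with rfl | hk
      · exact hx
      · exact h1 k hk
    · refine ⟨[], x :: t, rfl, by simp, fun k hk => ?_⟩
      rcases List.mem_cons.1 hk with rfl | hk
      · omega
      · have : (x : ℤ) < k := hl.1 k hk
        omega

theorem rank_inv_add_rank (σ : Equiv.Perm X) {p q : List X} (h : elems X = p ++ q) {c : ℤ}
    (hp : ∀ k ∈ p, (k : ℤ) < c) (hq : ∀ k ∈ q, c ≤ (k : ℤ)) (a b : ℤ) :
    rank σ⁻¹ a c + rank σ c b = (p.map fun k => (σ k : ℤ)).countP (a ≤ ·) +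
      (q.map fun k => (σ k : ℤ)).countP (· < b) := by
  rw [rank_inv, rank, h, List.countP_append, List.countP_append, List.countP_map, List.countP_map]
  have h1 : q.countP (fun k : X => decide ((k : ℤ) < c ∧ a ≤ (σ k : ℤ))) = 0 := by
    rw [List.countP_eq_zero]
    intro k hk h
    exact (of_decide_eq_true h).1.not_ge (hq k hk)
  have h2 : p.countP (fun k : X => decide (c ≤ (k : ℤ) ∧ (σ k : ℤ) < b)) = 0 := by
    rw [List.countP_eq_zero]
    intro k hk h
    exact (of_decide_eq_true h).1.not_gt (hp k hk)
  rw [h1, h2, add_zero, zero_add]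
  congr 1
  · refine List.countP_congr fun k hk => ?_
    simp [hp k hk]
  · refine List.countP_congr fun k hk => ?_
    simp [hq k hk]

/-- A threshold `c` on positions is the same as a cut of the word of `σ`, and the term at `c` is the
cost of that cut (`rank_inv_add_rank`). -/
theorem rank_eq_splitMin {ζ σ : Equiv.Perm X} {b : ℤ}
    (h : IsMinPlus (fun a => rank ζ a b) (rank σ⁻¹) (fun a => rank σ a b)) (a : ℤ) :
    rank ζ a b = splitMin a b (oneLineA σ) := by
  obtain ⟨h1, c, h2⟩ := h a
  rw [oneLineA_eq_map]
  apply le_antisymm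
  · obtain ⟨P, Q, e, h3⟩ := exists_splitMin_eq a b ((elems X).map fun k => (σ k : ℤ))
    obtain ⟨p, q, e', rfl, rfl⟩ := List.map_eq_append_iff.1 e
    obtain ⟨c', hp, hq⟩ := exists_threshold (elems_pairwise X) e'
    rw [h3, ← rank_inv_add_rank σ e' hp hq]
    exact h1 c'
  · obtain ⟨p, q, e, hp, hq⟩ := exists_split_at (elems_pairwise X) c
    change rank ζ a b = _ at h2
    rw [h2, rank_inv_add_rank σ e hp hq, e, List.map_append]
    exact splitMin_append_le a b _ _

/-- The rank function of `u ∘ u⁻¹`. -/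
theorem HasRankSteps.rank_demazure_inv {φ : G →* Equiv.Perm X} (h : HasRankSteps S φ) {u : G}
    (hu : ∃ l, IsWordFor S l u⁻¹) (a b : ℤ) :
    rank (φ (demazure S u u⁻¹)) a b = splitMin a b (oneLineA (φ u)) := by
  refine rank_eq_splitMin ?_ a
  have := h.rank_demazure u hu b
  rwa [map_inv] at this

theorem rank_inv_add (σ : Equiv.Perm X) (a b : ℤ) :
    rank σ⁻¹ a b + (oneLineA σ).countP (· < a) = rank σ b a + (oneLineA σ).countP (· < b) := by
  have h1 : (oneLineA σ).countP (· < b) = (elems X).countP fun k : X => (k : ℤ) < b := by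
    rw [oneLineA_eq_map, ← (elems_map_perm σ).countP_eq, List.countP_map, List.countP_map]
    rfl
  rw [h1, oneLineA_eq_map, List.countP_map, rank_inv, rank]
  generalize elems X = t
  induction t with
  | nil => rfl
  | cons k t ih =>
    simp only [List.countP_cons, decide_eq_true_eq, Function.comp] at ih ⊢
    split_ifs <;> omega

/-- Inverting a permutation exchanges the two thresholds of its rank function up to letter counts,
and `splitMin` obeys the same rule with `a` and `b` exchanged (`splitMin_comm`). -/
theorem inv_eq_self_of_rank_eq_splitMin {ζ σ : Equiv.Perm X}
    (h : ∀ a b, rank ζ a b = splitMin a b (oneLineA σ)) : ζ⁻¹ = ζ := by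
  refine rank_injective fun a b => ?_
  have h1 := rank_inv_add ζ a b
  have h2 := splitMin_comm a b (oneLineA σ)
  have hp : (oneLineA ζ).Perm (oneLineA σ) :=
    (List.perm_ext_iff_of_nodup (oneLineA_nodup _) (oneLineA_nodup _)).2 fun c => by
      rw [mem_oneLineA, mem_oneLineA]
  rw [hp.countP_eq, hp.countP_eq, h] at h1
  rw [h]
  omega

end MinPlus

/-! ### Inverse atoms in `S_X` -/

section TypeALength

variable {X : Finset ℤ}

theorem length_simpleA (σ : Equiv.Perm X) :
    (∃ l, IsWordFor (simpleA X) l σ) ∧ length (simpleA X) σ = inversions (oneLineA σ) := by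
  have := mul_length_eq (S := simpleA X) (k := 1) one_pos
    (L := fun σ => inversions (oneLineA σ)) inversions_one ?_ ?_ ?_ σ
  · simpa using this
  · rintro s ⟨a, b, -, rfl⟩
    exact Equiv.swap_mul_self a b
  · rintro g s ⟨a, b, hab, rfl⟩
    rcases lt_or_gt_of_ne (g.injective.ne hab.lt.ne) with h | h
    · exact (inversions_mul_swap g hab h).le
    · have := inversions_mul_swap' g hab h
      omega
  · intro g hg
    obtain ⟨x, y, hxy, h⟩ := exists_covBy_of_ne_one hg
    exact ⟨_, ⟨x, y, hxy, rfl⟩, inversions_mul_swap' g hxy h⟩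

theorem hasRankSteps_simpleA : HasRankSteps (simpleA X) (MonoidHom.id (Equiv.Perm X)) := by
  rintro s ⟨x, y, hxy, rfl⟩
  refine ⟨rankStep x y, fun F M U h => h.rankStep x y, fun u a b => ?_⟩
  rw [← rank_sortAt _ hxy]
  congr 1
  simp only [MonoidHom.id_apply, demazureStep, sortAt, (length_simpleA _).2]
  rcases lt_or_gt_of_ne (u.injective.ne hxy.lt.ne) with h | h
  · rw [inversions_mul_swap u hxy h, if_pos (by omega), if_pos h]
  · have := inversions_mul_swap' u hxy h
    rw [if_neg (by omega), if_neg h.not_gt]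

theorem rank_demazureA (σ : Equiv.Perm X) (a b : ℤ) :
    rank (demazure (simpleA X) σ σ⁻¹) a b = splitMin a b (oneLineA σ) :=
  hasRankSteps_simpleA.rank_demazure_inv (length_simpleA _).1 a b

theorem mem_invAtoms_iff {G : Type*} [Group G] {S : Set G} (hS : ∀ s ∈ S, s⁻¹ ∈ S) {z w : G} :
    w ∈ invAtoms S z ↔ demazure S w w⁻¹ = z ∧
      ∀ v, demazure S v v⁻¹ = z → length S w ≤ length S v := by
  simp only [invAtoms, atoms, heckeAtoms, Set.mem_ofPred_eq, inv_inv, length_inv hS]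
  refine and_congr_right fun _ => ⟨fun h v hv => ?_, fun h v hv => ?_⟩
  · rw [← length_inv hS v]
    exact h v⁻¹ (by rwa [inv_inv])
  · rw [← length_inv hS v]
    exact h v⁻¹ (by rwa [inv_inv])

theorem mem_invAtomsA_iff {ζ w : Equiv.Perm X} :
    w ∈ invAtoms (simpleA X) ζ ↔ (∀ a b, rank ζ a b = splitMin a b (oneLineA w)) ∧
      ∀ v : Equiv.Perm X, (∀ a b, rank ζ a b = splitMin a b (oneLineA v)) →
        inversions (oneLineA w) ≤ inversions (oneLineA v) := by
  have key : ∀ v : Equiv.Perm X, demazure (simpleA X) v v⁻¹ = ζ ↔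
      ∀ a b, rank ζ a b = splitMin a b (oneLineA v) := by
    intro v
    constructor
    · rintro rfl a b
      exact rank_demazureA v a b
    · intro h
      exact rank_injective fun a b => by rw [rank_demazureA, h]
  rw [mem_invAtoms_iff]
  · simp only [key, (length_simpleA _).2]
  · rintro s ⟨a, b, hab, rfl⟩
    exact ⟨a, b, hab, Equiv.swap_inv a b⟩

theorem exists_oneLineA_of_perm {σ : Equiv.Perm X} {l : List ℤ} (h : (oneLineA σ).Perm l) :
    ∃ τ : Equiv.Perm X, oneLineA τ = l :=
  exists_oneLineA_eq (h.nodup_iff.1 (oneLineA_nodup σ)) fun a => by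
    rw [← h.mem_iff, mem_oneLineA]

/-- Replacing `cba` by `cab` would give a shorter word with the same `splitMin`. -/
theorem isDescentFree_of_mem_invAtomsA {ζ σ : Equiv.Perm X} (h : σ ∈ invAtoms (simpleA X) ζ) :
    IsDescentFree (oneLineA σ) := by
  rw [mem_invAtomsA_iff] at h
  intro p q a b c hab hbc hs
  have hp : (p ++ [c, b, a] ++ q).Perm (p ++ [c, a, b] ++ q) :=
    (((List.Perm.swap a b []).cons c).append_left p).append_right q
  obtain ⟨τ, hτ⟩ := exists_oneLineA_of_perm (hs.perm.trans hp)
  have h1 := h.2 τ fun x y => by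
    rw [h.1, hs.splitMin_eq, hτ, splitMin_cab_cba hab hbc]
  rw [hs.inversions_eq, hτ, inversions_cba hab] at h1
  omega

/-- If the class of `σ` under `∼_A` avoids consecutive letters `c b a` with `a < b < c`, then
it is `𝒜(ζ)⁻¹` for the involution `ζ = σ ∘ σ⁻¹`. -/
theorem exists_invAtomsA_eq {σ : Equiv.Perm X} (h : IsDescentFree (oneLineA σ)) :
    ∃ ζ : Equiv.Perm X, ζ⁻¹ = ζ ∧
      ∀ τ, τ ∈ invAtoms (simpleA X) ζ ↔ SimA (oneLineA σ) (oneLineA τ) := by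
  refine ⟨demazure (simpleA X) σ σ⁻¹, inv_eq_self_of_rank_eq_splitMin (rank_demazureA σ), ?_⟩
  have hmin : ∀ τ ∈ invAtoms (simpleA X) (demazure (simpleA X) σ σ⁻¹),
      SimA (oneLineA σ) (oneLineA τ) := by
    intro τ hτ
    have hf := isDescentFree_of_mem_invAtomsA hτ
    rw [mem_invAtomsA_iff] at hτ
    obtain ⟨m, h1, h2⟩ := h.simA_of_splitMin_eq hf (oneLineA_nodup σ)
      ((List.perm_ext_iff_of_nodup (oneLineA_nodup _) (oneLineA_nodup _)).2 fun c => by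
        rw [mem_oneLineA, mem_oneLineA]) fun a b => by rw [← hτ.1, rank_demazureA]
    exact h1.simA.symm.trans h2.simA
  refine fun τ => ⟨hmin τ, fun hs => ?_⟩
  have hfin : {τ : Equiv.Perm X | ∀ a b, rank (demazure (simpleA X) σ σ⁻¹) a b =
    splitMin a b (oneLineA τ)}.Finite := Set.toFinite _
  -- A shortest `ρ` with the right `splitMin` is an inverse atom, so it lies in the class of `σ`.
  -- Inversions are constant on the class, so all its members are as short as `ρ`.
  obtain ⟨ρ, hρ, hρ'⟩ := Set.exists_min_image _ (fun τ => inversions (oneLineA τ)) hfin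
    ⟨σ, rank_demazureA σ⟩
  have h1 := hmin ρ (mem_invAtomsA_iff.2 ⟨hρ, hρ'⟩)
  rw [mem_invAtomsA_iff]
  refine ⟨fun a b => by rw [rank_demazureA, hs.splitMin_eq], fun v hv => ?_⟩
  rw [← hs.inversions_eq, h1.inversions_eq]
  exact hρ' v hv

end TypeALength


/-! ### Doubled words of signed permutations -/

section SignedWords

variable {n : ℕ}

theorem hyperoctahedral_apply_neg (w : hyperoctahedral n) (i : pm n) :
    (w : Equiv.Perm (pm n)) (-i) = -(w : Equiv.Perm (pm n)) i := w.2 i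

theorem exists_pos_eq {x : pm n} (h : 0 < (x : ℤ)) : ∃ i : Fin n, pos i = x := by
  have hx := mem_pm.1 x.2
  refine ⟨⟨((x : ℤ) - 1).toNat, by omega⟩, ?_⟩
  apply Subtype.ext
  simp only [pos]
  omega

theorem neg_neg_pm (x : pm n) : - -x = x := Subtype.ext (neg_neg (x : ℤ))

theorem elems_pm : elems (pm n) =
    ((List.ofFn (pos (n := n))).map fun x => -x).reverse ++ List.ofFn (pos (n := n)) := by
  have h0 : (List.ofFn (pos (n := n))).Pairwise (· < ·) := by
    rw [List.pairwise_ofFn]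
    intro i j h
    rw [← Subtype.coe_lt_coe]
    have : (i : ℕ) < j := h
    simp only [pos]
    omega
  have hpos : ∀ x ∈ List.ofFn (pos (n := n)), 0 < (x : ℤ) := by
    intro x hx
    obtain ⟨i, rfl⟩ := List.mem_ofFn.1 hx
    simp only [pos]
    omega
  refine (elems_pairwise (pm n)).eq_of_mem_iff ?_ fun x => ⟨fun _ => ?_, fun _ => mem_elems x⟩
  · rw [List.pairwise_append, List.pairwise_reverse, List.pairwise_map]
    refine ⟨h0.imp fun {x y} h => ?_, h0, fun x hx y hy => ?_⟩
    · have h' : (x : ℤ) < y := h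
      rw [← Subtype.coe_lt_coe, coe_neg_pm, coe_neg_pm]
      omega
    · rw [List.mem_reverse, List.mem_map] at hx
      obtain ⟨x, hx, rfl⟩ := hx
      have := hpos x hx
      have := hpos y hy
      rw [← Subtype.coe_lt_coe, coe_neg_pm]
      omega
  · rw [List.mem_append, List.mem_reverse, List.mem_map]
    have hx := mem_pm.1 x.2
    rcases lt_or_gt_of_ne hx.1 with h | h
    · left
      obtain ⟨i, hi⟩ := exists_pos_eq (x := -x) (by rw [coe_neg_pm]; omega)
      exact ⟨-x, List.mem_ofFn.2 ⟨i, hi⟩, neg_neg_pm x⟩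
    · right
      obtain ⟨i, hi⟩ := exists_pos_eq h
      exact List.mem_ofFn.2 ⟨i, hi⟩

theorem oneLineB_eq_map (w : hyperoctahedral n) : oneLineB w =
    (List.ofFn (pos (n := n))).map fun k => ((w : Equiv.Perm (pm n)) k : ℤ) := by
  rw [List.map_ofFn]
  rfl

/-- The word `w(-n) ⋯ w(-1) w(1) ⋯ w(n)` in terms of the one-line representation of `w ∈ W_n`. -/
theorem oneLineA_hyperoctahedral (w : hyperoctahedral n) :
    oneLineA (w : Equiv.Perm (pm n)) = negRev (oneLineB w) ++ oneLineB w := by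
  rw [oneLineA_eq_map, elems_pm, List.map_append, oneLineB_eq_map, negRev, List.map_reverse,
    List.map_map, List.map_map]
  congr 3
  funext k
  simp only [Function.comp, hyperoctahedral_apply_neg, coe_neg_pm]

theorem rank_one_zero_hyperoctahedral (w : hyperoctahedral n) :
    rank (w : Equiv.Perm (pm n)) 1 0 = (oneLineB w).countP (· < 0) := by
  rw [rank, elems_pm, List.countP_append, oneLineB_eq_map, List.countP_map]
  have h1 : (((List.ofFn (pos (n := n))).map fun x => -x).reverse).countP
      (fun k : pm n => decide (1 ≤ (k : ℤ) ∧ ((w : Equiv.Perm (pm n)) k : ℤ) < 0)) = 0 := by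
    rw [List.countP_eq_zero]
    intro k hk h
    rw [List.mem_reverse, List.mem_map] at hk
    obtain ⟨x, hx, rfl⟩ := hk
    obtain ⟨i, rfl⟩ := List.mem_ofFn.1 hx
    have := (of_decide_eq_true h).1
    rw [coe_neg_pm] at this
    simp only [pos] at this
    omega
  rw [h1, zero_add]
  refine List.countP_congr fun k hk => ?_
  obtain ⟨i, rfl⟩ := List.mem_ofFn.1 hk
  simp [pos]

theorem isHalf_toFinset (w : hyperoctahedral n) : IsHalf n (oneLineB w).toFinset := by
  have hn := oneLineA_nodup (w : Equiv.Perm (pm n))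
  have hm : ∀ a, a ∈ oneLineA (w : Equiv.Perm (pm n)) ↔ a ∈ pm n := fun a => mem_oneLineA _
  rw [oneLineA_hyperoctahedral, List.nodup_append] at hn
  constructor
  · ext a
    rw [← hm, oneLineA_hyperoctahedral]
    simp [negRev, or_comm]
  · rw [Finset.disjoint_left]
    intro a ha hb
    rw [List.mem_toFinset] at ha
    refine hn.2.2 a ?_ a ha rfl
    simpa [negRev] using hb

theorem oneLineB_nodup (w : hyperoctahedral n) : (oneLineB w).Nodup := by
  have hn := oneLineA_nodup (w : Equiv.Perm (pm n))
  rw [oneLineA_hyperoctahedral, List.nodup_append] at hn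
  exact hn.2.1

theorem exists_oneLineB_of_perm {w : hyperoctahedral n} {l : List ℤ} (h : (oneLineB w).Perm l) :
    ∃ v : hyperoctahedral n, oneLineB v = l := by
  obtain ⟨σ, hσ⟩ := exists_oneLineA_eq (X := (oneLineB w).toFinset)
    (h.nodup_iff.1 (oneLineB_nodup w)) fun a => by rw [List.mem_toFinset, h.mem_iff]
  obtain ⟨v, hv⟩ := exists_oneLineB_eq (isHalf_toFinset w) σ
  exact ⟨v, hv.trans hσ⟩

theorem CoverA.append_left {v w : List ℤ} (h : CoverA v w) (l : List ℤ) :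
    CoverA (l ++ v) (l ++ w) := by
  obtain ⟨p, q, a, b, c, hab, hbc, rfl, rfl⟩ := h
  exact ⟨l ++ p, q, a, b, c, hab, hbc, by simp, by simp⟩

theorem CoverA.append_right {v w : List ℤ} (h : CoverA v w) (l : List ℤ) :
    CoverA (v ++ l) (w ++ l) := by
  obtain ⟨p, q, a, b, c, hab, hbc, rfl, rfl⟩ := h
  exact ⟨p, q ++ l, a, b, c, hab, hbc, by simp, by simp⟩

/-- A move in each half. The two moves go in opposite directions because `negRev` reverses covers,
so only `∼_A` is preserved. -/
theorem CoverA.negRev_append_self {v w : List ℤ} (h : CoverA v w) :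
    SimA (SignedAtoms.negRev v ++ v) (SignedAtoms.negRev w ++ w) :=
  (LtA.simA (.single (h.negRev.append_right v))).symm.trans
    (LtA.simA (.single (h.append_left (SignedAtoms.negRev w))))

theorem SimA.negRev_append_self {v w : List ℤ} (h : SimA v w) :
    SimA (SignedAtoms.negRev v ++ v) (SignedAtoms.negRev w ++ w) := by
  rw [simA_iff] at h
  induction h with
  | rel x y h => exact h.negRev_append_self
  | refl x => exact .refl _
  | symm x y _ ih => exact ih.symm
  | trans x y z _ _ h1 h2 => exact h1.trans h2

theorem negRev_append_self_cba (p q : List ℤ) (a b c : ℤ) :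
    negRev (p ++ [c, b, a] ++ q) ++ (p ++ [c, b, a] ++ q) =
      negRev q ++ [-a, -b, -c] ++ (negRev p ++ p ++ [c, b, a] ++ q) := by
  simp [negRev]

theorem splitMin_negRev_append_self_cba {a b c : ℤ} (hab : a < b) (hbc : b < c) (p q : List ℤ)
    (A B : ℤ) : splitMin A B (negRev (p ++ [c, b, a] ++ q) ++ (p ++ [c, b, a] ++ q)) =
      splitMin A B (negRev (p ++ [c, a, b] ++ q) ++ (p ++ [c, a, b] ++ q)) := by
  -- The left half holds `-a, -b, -c`, again a decreasing block; it reaches `-b, -a, -c` by a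
  -- `cba`-to-`cab` exchange followed by a `cab`-to-`bca` move.
  rw [negRev_append_self_cba, negRev_append_self_cba,
    ← splitMin_cab_cba (neg_lt_neg hbc) (neg_lt_neg hab),
    splitMin_cab_bca (neg_lt_neg hbc) (neg_lt_neg hab)]
  have h := splitMin_cab_cba hab hbc A B (negRev q ++ [-b, -a, -c] ++ (negRev p ++ p)) q
  simpa using h.symm

theorem inversions_negRev_append_self_cba {a b c : ℤ} (hab : a < b)
    (p q : List ℤ) : inversions (negRev (p ++ [c, b, a] ++ q) ++ (p ++ [c, b, a] ++ q)) =
      inversions (negRev (p ++ [c, a, b] ++ q) ++ (p ++ [c, a, b] ++ q)) + 2 := by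
  rw [negRev_append_self_cba, negRev_append_self_cba]
  have h1 := inversions_cba (c := c) hab (negRev q ++ [-a, -b, -c] ++ (negRev p ++ p)) q
  have h2 := inversions_swap (neg_lt_neg hab) (negRev q)
    (-c :: (negRev p ++ p ++ [c, a, b] ++ q))
  simp only [List.append_assoc, List.cons_append, List.nil_append] at h1 h2 ⊢
  omega

end SignedWords

/-! ### Length, Demazure product and inverse atoms in `W_n` -/

section TypeBLength

variable {n : ℕ}

theorem pm_covBy_of_eq_add_one {a b : pm n} (h : (b : ℤ) = a + 1) : a ⋖ b := by
  refine ⟨?_, fun c h1 h2 => ?_⟩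
  · rw [← Subtype.coe_lt_coe]
    omega
  · have h1' : (a : ℤ) < c := h1
    have h2' : (c : ℤ) < b := h2
    omega

theorem pm_neg_covBy_neg {a b : pm n} (h : (b : ℤ) = a + 1) : -b ⋖ -a := by
  apply pm_covBy_of_eq_add_one
  rw [coe_neg_pm, coe_neg_pm]
  omega

theorem pm_neg_covBy_self {a : pm n} (h : (a : ℤ) = 1) : -a ⋖ a := by
  refine ⟨?_, fun c h1 h2 => ?_⟩
  · rw [← Subtype.coe_lt_coe, coe_neg_pm]
    omega
  · have h1' : ((-a : pm n) : ℤ) < c := h1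
    have h2' : (c : ℤ) < a := h2
    rw [coe_neg_pm] at h1'
    have := (mem_pm.1 c.2).1
    omega

theorem pm_eq_of_covBy {x y : pm n} (h : x ⋖ y) :
    (y : ℤ) = x + 1 ∨ ((y : ℤ) = 1 ∧ x = -y) := by
  have hlt : (x : ℤ) < y := h.lt
  have hx := mem_pm.1 x.2
  have hy := mem_pm.1 y.2
  by_cases h0 : (x : ℤ) = -1
  · right
    by_cases h1 : (y : ℤ) = 1
    · exact ⟨h1, Subtype.ext (by rw [coe_neg_pm]; omega)⟩
    · have hc : (1 : ℤ) ∈ pm n := by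
        rw [mem_pm]
        omega
      refine absurd ?_ (h.2 (c := ⟨1, hc⟩) ?_) <;> rw [← Subtype.coe_lt_coe] <;> simp only <;> omega
  · left
    by_contra hne
    have hc : (x : ℤ) + 1 ∈ pm n := by
      rw [mem_pm]
      omega
    refine absurd ?_ (h.2 (c := ⟨x + 1, hc⟩) ?_) <;> rw [← Subtype.coe_lt_coe] <;> simp only <;>
      omega

/-- Twice the length function of `W_n`. -/
noncomputable def signedInversions (w : hyperoctahedral n) : ℕ :=
  inversions (oneLineA (w : Equiv.Perm (pm n))) + rank (w : Equiv.Perm (pm n)) 1 0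

theorem hyperoctahedral_neg_lt (w : hyperoctahedral n) {x y : pm n}
    (h : (w : Equiv.Perm (pm n)) x < (w : Equiv.Perm (pm n)) y) :
    (w : Equiv.Perm (pm n)) (-y) < (w : Equiv.Perm (pm n)) (-x) := by
  rw [hyperoctahedral_apply_neg, hyperoctahedral_apply_neg, ← Subtype.coe_lt_coe, coe_neg_pm,
    coe_neg_pm]
  exact neg_lt_neg h

theorem rank_neg_self (σ : Equiv.Perm (pm n)) {a : pm n} (ha : (a : ℤ) = 1) :
    rank (σ * Equiv.swap (-a) a) 1 0 + (if (σ a : ℤ) < 0 then 1 else 0) =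
      rank σ 1 0 + (if (σ (-a) : ℤ) < 0 then 1 else 0) := by
  have h1 := rank_coe σ a 0
  have h2 := rank_coe (σ * Equiv.swap (-a) a) a 0
  rw [rank_mul_swap_of_iff σ (a := (a : ℤ) + 1) (by rw [coe_neg_pm]; omega),
    Equiv.Perm.mul_apply, Equiv.swap_apply_right] at h2
  rw [ha] at h1 h2
  omega

/-- The inversion number of the doubled word and the number of negative letters each change by one,
in the same direction. -/
theorem signedInversions_mul_of_lt {w t : hyperoctahedral n} {a : pm n} (ha : (a : ℤ) = 1)
    (ht : (t : Equiv.Perm (pm n)) = Equiv.swap (-a) a) :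
    if (w : Equiv.Perm (pm n)) (-a) < (w : Equiv.Perm (pm n)) a
    then signedInversions (w * t) = signedInversions w + 2
    else signedInversions (w * t) + 2 = signedInversions w := by
  have hc := pm_neg_covBy_self ha
  have h1 := rank_neg_self (w : Equiv.Perm (pm n)) ha
  have hn := coe_neg_pm ((w : Equiv.Perm (pm n)) a)
  rw [← hyperoctahedral_apply_neg] at hn
  simp only [signedInversions, Subgroup.coe_mul, ht]
  rcases lt_or_gt_of_ne ((w : Equiv.Perm (pm n)).injective.ne hc.lt.ne) with h | h
  · rw [if_pos h, inversions_mul_swap _ hc h]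
    rw [← Subtype.coe_lt_coe] at h
    rw [if_neg (by omega), if_pos (by omega)] at h1
    omega
  · rw [if_neg h.not_gt]
    have h2 := inversions_mul_swap' _ hc h
    rw [← Subtype.coe_lt_coe] at h
    rw [if_pos (by omega), if_neg (by omega)] at h1
    omega

theorem mul_swap_neg_apply (σ : Equiv.Perm (pm n)) {a b : pm n} (ha : 0 < (a : ℤ))
    (hb : (b : ℤ) = a + 1) : (σ * Equiv.swap (-b) (-a)) a = σ a ∧
      (σ * Equiv.swap (-b) (-a)) b = σ b := by
  have hne : ∀ x y : pm n, 0 < (x : ℤ) → 0 < (y : ℤ) → x ≠ -y := by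
    intro x y hx hy h
    have := congrArg Subtype.val h
    rw [coe_neg_pm] at this
    omega
  constructor <;> rw [Equiv.Perm.mul_apply, Equiv.swap_apply_of_ne_of_ne] <;>
    apply hne <;> omega

/-- The two mirrored swaps each change the inversion number by one, and neither moves a letter
across 0, so the number of negative letters is kept. -/
theorem signedInversions_mul_of_lt' {w t : hyperoctahedral n} {a b : pm n} (ha : 0 < (a : ℤ))
    (hb : (b : ℤ) = a + 1)
    (ht : (t : Equiv.Perm (pm n)) = Equiv.swap (-a) (-b) * Equiv.swap a b) :
    if (w : Equiv.Perm (pm n)) a < (w : Equiv.Perm (pm n)) b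
    then signedInversions (w * t) = signedInversions w + 2
    else signedInversions (w * t) + 2 = signedInversions w := by
  have hc := pm_covBy_of_eq_add_one hb
  have hc' := pm_neg_covBy_neg hb
  obtain ⟨h1, h2⟩ := mul_swap_neg_apply (w : Equiv.Perm (pm n)) ha hb
  rw [Equiv.swap_comm (-a) (-b)] at ht
  simp only [signedInversions, Subgroup.coe_mul, ht, ← mul_assoc]
  rw [rank_mul_swap_of_iff _ (by omega),
    rank_mul_swap_of_iff _ (by rw [coe_neg_pm, coe_neg_pm]; omega)]
  rcases lt_or_gt_of_ne ((w : Equiv.Perm (pm n)).injective.ne hc.lt.ne) with h | h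
  · rw [if_pos h, inversions_mul_swap _ hc (by rwa [h1, h2]),
      inversions_mul_swap _ hc' (hyperoctahedral_neg_lt w h)]
    omega
  · rw [if_neg h.not_gt]
    have h3 := inversions_mul_swap' _ hc' (hyperoctahedral_neg_lt w h)
    have h4 := inversions_mul_swap' _ hc (h1 ▸ h2 ▸ h)
    omega

theorem commute_swap_neg {a b : pm n} (ha : 0 < (a : ℤ)) (hb : (b : ℤ) = a + 1) :
    Commute (Equiv.swap (-a) (-b)) (Equiv.swap a b) := by
  obtain ⟨h1, h2⟩ := mul_swap_neg_apply 1 ha hb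
  have h3 := Equiv.swap_apply_apply (Equiv.swap (-b) (-a)) a b
  rw [one_mul] at h1 h2
  rw [h1, h2, eq_mul_inv_iff_mul_eq] at h3
  rw [Equiv.swap_comm (-a) (-b)]
  exact h3.symm

theorem simpleB_mul_self {t : hyperoctahedral n} (ht : t ∈ simpleB n) : t * t = 1 := by
  apply Subtype.ext
  rcases ht with ⟨a, ha, ht⟩ | ⟨a, b, ha, hb, ht⟩
  · rw [Subgroup.coe_mul, ht]
    exact Equiv.swap_mul_self _ _
  · rw [Subgroup.coe_mul, ht, mul_assoc, ← mul_assoc (Equiv.swap a b),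
      ← (commute_swap_neg ha hb).eq, mul_assoc, Equiv.swap_mul_self, mul_one, Equiv.swap_mul_self]
    rfl

theorem exists_simpleB_swap {a : pm n} (ha : (a : ℤ) = 1) :
    ∃ t ∈ simpleB n, (t : Equiv.Perm (pm n)) = Equiv.swap (-a) a := by
  refine ⟨⟨Equiv.swap (-a) a, fun i => ?_⟩, .inl ⟨a, ha, rfl⟩, rfl⟩
  rcases eq_or_ne i a with rfl | h1
  · rw [Equiv.swap_apply_left, Equiv.swap_apply_right, neg_neg_pm]
  · rcases eq_or_ne i (-a) with rfl | h2
    · rw [neg_neg_pm, Equiv.swap_apply_right, Equiv.swap_apply_left]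
    · rw [Equiv.swap_apply_of_ne_of_ne h2 h1, Equiv.swap_apply_of_ne_of_ne]
      · rintro h
        exact h1 (by rw [← neg_neg_pm i, h, neg_neg_pm])
      · rintro h
        exact h2 (by rw [← neg_neg_pm i, h])

theorem swap_neg_apply (a b i : pm n) :
    Equiv.swap (-a) (-b) (-i) = -Equiv.swap a b i := by
  have hinj : Function.Injective fun x : pm n => -x :=
    Function.LeftInverse.injective (g := fun x => -x) neg_neg_pm
  exact (hinj.map_swap a b i).symm

theorem exists_simpleB_swap_mul_swap {a b : pm n} (ha : 0 < (a : ℤ)) (hb : (b : ℤ) = a + 1) :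
    ∃ t ∈ simpleB n,
      (t : Equiv.Perm (pm n)) = Equiv.swap (-a) (-b) * Equiv.swap a b := by
  refine ⟨⟨Equiv.swap (-a) (-b) * Equiv.swap a b, fun i => ?_⟩, .inr ⟨a, b, ha, hb, rfl⟩, rfl⟩
  have h4 := swap_neg_apply (-a) (-b) i
  rw [neg_neg_pm, neg_neg_pm] at h4
  have h5 := DFunLike.congr_fun (commute_swap_neg ha hb).eq i
  simp only [Equiv.Perm.mul_apply] at h5 ⊢
  rw [h4, swap_neg_apply, h5]

theorem signedInversions_one : signedInversions (1 : hyperoctahedral n) = 0 := by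
  rw [signedInversions, OneMemClass.coe_one, inversions_one, zero_add, rank, List.countP_eq_zero]
  intro k _ h
  have h1 := (of_decide_eq_true h).1
  have h2 : (k : ℤ) < 0 := (of_decide_eq_true h).2
  omega

theorem length_simpleB (w : hyperoctahedral n) :
    (∃ l, IsWordFor (simpleB n) l w) ∧ 2 * length (simpleB n) w = signedInversions w := by
  refine mul_length_eq two_pos signedInversions_one (fun s hs => simpleB_mul_self hs) ?_ ?_ w
  · rintro g t (⟨a, ha, ht⟩ | ⟨a, b, ha, hb, ht⟩)
    · have h := signedInversions_mul_of_lt (w := g) ha ht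
      split_ifs at h <;> omega
    · have h := signedInversions_mul_of_lt' (w := g) ha hb ht
      split_ifs at h <;> omega
  · intro g hg
    obtain ⟨x, y, hxy, h⟩ := exists_covBy_of_ne_one (σ := (g : Equiv.Perm (pm n)))
      fun h => hg (Subtype.ext h)
    have hx := mem_pm.1 x.2
    have hy := mem_pm.1 y.2
    have key : ∀ a b : pm n, 0 < (a : ℤ) → (b : ℤ) = a + 1 →
        (g : Equiv.Perm (pm n)) b < (g : Equiv.Perm (pm n)) a →
        ∃ s ∈ simpleB n, signedInversions (g * s) + 2 = signedInversions g := by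
      intro a b ha hb h
      obtain ⟨t, ht, ht'⟩ := exists_simpleB_swap_mul_swap ha hb
      have h' := signedInversions_mul_of_lt' (w := g) ha hb ht'
      rw [if_neg h.not_gt] at h'
      exact ⟨t, ht, h'⟩
    rcases pm_eq_of_covBy hxy with hb | ⟨hy1, rfl⟩
    · by_cases h0 : 0 < (x : ℤ)
      · exact key x y h0 hb h
      -- A descent at negative positions is mirrored to one at positive positions.
      · exact key (-y) (-x) (by rw [coe_neg_pm]; omega)
          (by rw [coe_neg_pm, coe_neg_pm]; omega) (hyperoctahedral_neg_lt g h)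
    · obtain ⟨t, ht, ht'⟩ := exists_simpleB_swap hy1
      have h' := signedInversions_mul_of_lt (w := g) hy1 ht'
      rw [if_neg h.not_gt] at h'
      exact ⟨t, ht, h'⟩

theorem length_lt_length_iff {u v : hyperoctahedral n} :
    length (simpleB n) u < length (simpleB n) v ↔ signedInversions u < signedInversions v := by
  rw [← (length_simpleB u).2, ← (length_simpleB v).2]
  omega

/-- A step by `t₀` is one sorting step of `[±n]`. A step by another generator is two sorting steps
at disjoint mirrored pairs, which by `w(-i) = -w(i)` both swap or both do nothing. -/
theorem hasRankSteps_simpleB : HasRankSteps (simpleB n) (hyperoctahedral n).subtype := by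
  rintro t (⟨a, ha, ht⟩ | ⟨a, b, ha, hb, ht⟩)
  · have hc := pm_neg_covBy_self ha
    refine ⟨rankStep (-a : pm n) a, fun F M U h => h.rankStep _ _, fun u x y => ?_⟩
    refine Eq.trans ?_ (rank_sortAt (u : Equiv.Perm (pm n)) hc x y)
    change rank (demazureStep (simpleB n) u t : hyperoctahedral n).1 x y = _
    congr 1
    have h := signedInversions_mul_of_lt (w := u) ha ht
    rw [demazureStep]
    split_ifs at h with h1
    · rw [if_pos (length_lt_length_iff.2 (by omega)), sortAt_of_lt h1, Subgroup.coe_mul, ht]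
    · rw [if_neg (fun hl => by have := length_lt_length_iff.1 hl; omega), sortAt_of_not_lt h1]
  · have hc := pm_covBy_of_eq_add_one hb
    have hc' := pm_neg_covBy_neg hb
    refine ⟨fun F => rankStep a b (rankStep (-b : pm n) (-a : pm n) F),
      fun F M U h => (h.rankStep _ _).rankStep _ _, fun u x y => ?_⟩
    have h0 : (fun c => rank (sortAt (u : Equiv.Perm (pm n)) (-b) (-a)) c y) =
        rankStep (-b : pm n) (-a : pm n) (fun c => rank (u : Equiv.Perm (pm n)) c y) :=
      funext fun c => rank_sortAt _ hc' c y
    have h6 := rank_sortAt (sortAt (u : Equiv.Perm (pm n)) (-b) (-a)) hc x y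
    rw [h0] at h6
    refine Eq.trans ?_ h6
    change rank (demazureStep (simpleB n) u t : hyperoctahedral n).1 x y = _
    congr 1
    have h := signedInversions_mul_of_lt' (w := u) ha hb ht
    obtain ⟨h2, h3⟩ := mul_swap_neg_apply (u : Equiv.Perm (pm n)) ha hb
    rw [demazureStep]
    split_ifs at h with h1
    · rw [if_pos (length_lt_length_iff.2 (by omega)), sortAt_of_lt (hyperoctahedral_neg_lt u h1), sortAt_of_lt,
        Subgroup.coe_mul, ht, mul_assoc, Equiv.swap_comm (-a) (-b)]
      rwa [h2, h3]
    · have h4 : ¬ (u : Equiv.Perm (pm n)) (-b) < (u : Equiv.Perm (pm n)) (-a) := by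
        intro h5
        have := hyperoctahedral_neg_lt u h5
        rw [neg_neg_pm, neg_neg_pm] at this
        exact h1 this
      rw [if_neg (fun hl => by have := length_lt_length_iff.1 hl; omega), sortAt_of_not_lt h4, sortAt_of_not_lt h1]

theorem simpleB_inv_mem {t : hyperoctahedral n} (ht : t ∈ simpleB n) : t⁻¹ ∈ simpleB n := by
  rwa [inv_eq_of_mul_eq_one_left (simpleB_mul_self ht)]

theorem mem_invAtomsB_iff {z w : hyperoctahedral n} :
    w ∈ invAtoms (simpleB n) z ↔
      (∀ a b, rank (z : Equiv.Perm (pm n)) a b =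
        splitMin a b (oneLineA (w : Equiv.Perm (pm n)))) ∧
      ∀ v : hyperoctahedral n, (∀ a b, rank (z : Equiv.Perm (pm n)) a b =
        splitMin a b (oneLineA (v : Equiv.Perm (pm n)))) →
        signedInversions w ≤ signedInversions v := by
  have hr : ∀ (v : hyperoctahedral n) a b,
      rank (demazure (simpleB n) v v⁻¹).1 a b =
        splitMin a b (oneLineA (v : Equiv.Perm (pm n))) :=
    fun v a b => hasRankSteps_simpleB.rank_demazure_inv (length_simpleB _).1 a b
  have key : ∀ v : hyperoctahedral n, demazure (simpleB n) v v⁻¹ = z ↔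
      ∀ a b, rank (z : Equiv.Perm (pm n)) a b =
        splitMin a b (oneLineA (v : Equiv.Perm (pm n))) := by
    intro v
    constructor
    · rintro rfl a b
      exact hr v a b
    · intro h
      exact Subtype.ext (rank_injective fun a b => by rw [hr, h])
  rw [mem_invAtoms_iff fun s => simpleB_inv_mem]
  simp only [key, ← (length_simpleB _).2]
  simp

theorem signedInversions_eq (w : hyperoctahedral n) : signedInversions w =
    inversions (negRev (oneLineB w) ++ oneLineB w) + (oneLineB w).countP (· < 0) := by
  rw [signedInversions, oneLineA_hyperoctahedral, rank_one_zero_hyperoctahedral]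

/-- `𝒜(z)⁻¹` is closed under `∼_A`. -/
theorem mem_invAtomsB_of_simA {z v w : hyperoctahedral n} (hv : v ∈ invAtoms (simpleB n) z)
    (h : SimA (oneLineB v) (oneLineB w)) : w ∈ invAtoms (simpleB n) z := by
  have hs := h.negRev_append_self
  rw [mem_invAtomsB_iff] at hv ⊢
  refine ⟨fun a b => ?_, fun u hu => ?_⟩
  · rw [hv.1, oneLineA_hyperoctahedral, oneLineA_hyperoctahedral, hs.splitMin_eq]
  · refine le_of_eq_of_le ?_ (hv.2 u hu)
    rw [signedInversions_eq, signedInversions_eq, hs.inversions_eq, h.perm.countP_eq]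

/-- As in `S_X`, but replacing `cba` by `cab` removes one inversion from each half of the doubled
word; the number of negative letters stays the same. -/
theorem isDescentFree_of_mem_invAtomsB {z v : hyperoctahedral n}
    (hv : v ∈ invAtoms (simpleB n) z) : IsDescentFree (oneLineB v) := by
  intro p q a b c hab hbc hs
  have hp : (p ++ [c, b, a] ++ q).Perm (p ++ [c, a, b] ++ q) :=
    (((List.Perm.swap a b []).cons c).append_left p).append_right q
  obtain ⟨w, hw⟩ := exists_oneLineB_of_perm hs.perm
  obtain ⟨u, hu⟩ := exists_oneLineB_of_perm (hs.perm.trans hp)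
  have hwz := mem_invAtomsB_of_simA hv (hw ▸ hs)
  rw [mem_invAtomsB_iff] at hwz
  have h1 := hwz.2 u fun x y => by
    rw [hwz.1, oneLineA_hyperoctahedral, oneLineA_hyperoctahedral, hw, hu,
      splitMin_negRev_append_self_cba hab hbc]
  rw [signedInversions_eq, signedInversions_eq, hw, hu, inversions_negRev_append_self_cba hab,
    hp.countP_eq] at h1
  omega

end TypeBLength


/-! ### Increasing relabellings of letters -/

section Relabel

theorem CoverA.map {f : ℤ → ℤ} {v w : List ℤ} (h : CoverA v w) {s : Set ℤ}
    (hs : ∀ x ∈ v, x ∈ s) (hf : StrictMonoOn f s) : CoverA (v.map f) (w.map f) := by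
  obtain ⟨p, q, a, b, c, hab, hbc, rfl, rfl⟩ := h
  exact ⟨p.map f, q.map f, f a, f b, f c, hf (hs a (by simp)) (hs b (by simp)) hab,
    hf (hs b (by simp)) (hs c (by simp)) hbc, by simp, by simp⟩

theorem LtA.map {f : ℤ → ℤ} {v w : List ℤ} (h : LtA v w) {s : Set ℤ}
    (hs : ∀ x ∈ v, x ∈ s) (hf : StrictMonoOn f s) : LtA (v.map f) (w.map f) := by
  induction h with
  | single h => exact .single (h.map hs hf)
  | tail h h' ih =>
    exact .tail ih (h'.map (fun x hx => hs x ((LtA.simA h).perm.mem_iff.2 hx)) hf)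

theorem SimA.map {f : ℤ → ℤ} {v w : List ℤ} (h : SimA v w) {s : Set ℤ}
    (hs : ∀ x ∈ v, x ∈ s) (hf : StrictMonoOn f s) : SimA (v.map f) (w.map f) := by
  rw [simA_iff] at h
  induction h with
  | rel x y h => exact LtA.simA (.single (h.map hs hf))
  | refl x => exact .refl _
  | symm x y h ih => exact (ih fun a ha => hs a ((simA_iff.2 h).perm.mem_iff.1 ha)).symm
  | trans x y z h _ h1 h2 =>
    exact (h1 hs).trans (h2 fun a ha => hs a ((simA_iff.2 h).perm.mem_iff.2 ha))

variable {l : List ℤ} {Y : Finset ℤ} {f g : ℤ → ℤ}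

theorem map_map_of_perm (hgf : ∀ x ∈ l, g (f x) = x) {v : List ℤ} (hv : l.Perm v) :
    (v.map f).map g = v := by
  rw [List.map_map]
  conv_rhs => rw [← List.map_id v]
  exact List.map_congr_left fun x hx => hgf x (hv.mem_iff.2 hx)

theorem IsDescentFree.map (h : IsDescentFree l) (hf : ∀ x ∈ l, f x ∈ Y)
    (hg : StrictMonoOn g Y) (hgf : ∀ x ∈ l, g (f x) = x) : IsDescentFree (l.map f) := by
  intro p q a b c hab hbc hs
  have hY : ∀ x ∈ l.map f, x ∈ (Y : Set ℤ) := by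
    intro x hx
    obtain ⟨y, hy, rfl⟩ := List.mem_map.1 hx
    exact hf y hy
  have h1 := hs.map hY hg
  rw [map_map_of_perm hgf (List.Perm.refl l), List.map_append, List.map_append] at h1
  have hm : ∀ x ∈ p ++ [c, b, a] ++ q, x ∈ (Y : Set ℤ) := fun x hx =>
    hY x (hs.perm.mem_iff.2 hx)
  exact h _ _ _ _ _ (hg (hm a (by simp)) (hm b (by simp)) hab)
    (hg (hm b (by simp)) (hm c (by simp)) hbc) h1

end Relabel

/-! ### Assembling the classes -/

section Main

variable {n : ℕ} {E : Set (hyperoctahedral n)} {l : List ℤ}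

/-- A class under `∼_A` that avoids consecutive letters `c b a` with `a < b < c` is isomorphic to
`𝒜(ζ)⁻¹` for an involution `ζ` of `S_Y`, whenever `Y` is a relabelling of its letters. -/
theorem exists_isoAtomPoset {v₀ : hyperoctahedral n}
    (hE : ∀ w, w ∈ E ↔ SimA (oneLineB v₀) (oneLineB w)) (hfree : IsDescentFree (oneLineB v₀))
    {Y : Finset ℤ} {f g : ℤ → ℤ} (hf : StrictMonoOn f {x | x ∈ oneLineB v₀})
    (hg : StrictMonoOn g Y) (hgf : ∀ x ∈ oneLineB v₀, g (f x) = x)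
    (hY : ∀ y, y ∈ Y ↔ ∃ x ∈ oneLineB v₀, f x = y) :
    ∃ ζ : Equiv.Perm Y, ζ⁻¹ = ζ ∧ IsoAtomPoset E ζ ∧
      ∀ τ, τ ∈ invAtoms (simpleA Y) ζ ↔ SimA ((oneLineB v₀).map f) (oneLineA τ) := by
  have hfY : ∀ x ∈ oneLineB v₀, f x ∈ Y := fun x hx => (hY _).2 ⟨x, hx, rfl⟩
  have hd : ((oneLineB v₀).map f).Nodup := (oneLineB_nodup v₀).map_on fun x hx y hy h => by
    rw [← hgf x hx, h, hgf y hy]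
  obtain ⟨σ, hσ⟩ := exists_oneLineA_eq (X := Y) hd fun a => by rw [hY, List.mem_map]
  have hfree' := hfree.map hfY hg hgf
  rw [← hσ] at hfree'
  obtain ⟨ζ, hζ, hiff⟩ := exists_invAtomsA_eq hfree'
  rw [hσ] at hiff
  refine ⟨ζ, hζ, ?_, hiff⟩
  have hEp : ∀ w : E, (oneLineB v₀).Perm (oneLineB w.1) := fun w => ((hE _).1 w.2).perm
  have hback : ∀ w : E, ((oneLineB w.1).map f).map g = oneLineB w.1 := fun w =>
    map_map_of_perm hgf (hEp w)
  have hex : ∀ w : E, ∃ τ : invAtoms (simpleA Y) ζ, oneLineA τ.1 = (oneLineB w.1).map f := by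
    intro w
    have hs := ((hE _).1 w.2).map (fun _ => id) hf
    obtain ⟨τ, hτ⟩ := exists_oneLineA_of_perm (σ := σ) (hσ ▸ hs.perm)
    exact ⟨⟨τ, (hiff τ).2 (hτ ▸ hs)⟩, hτ⟩
  choose e he using hex
  have hbij : Function.Bijective e := by
    constructor
    · intro v w h
      apply Subtype.ext
      apply oneLineB_injective
      rw [← hback v, ← hback w, ← he, ← he, h]
    · intro τ
      have hs := (hiff τ.1).1 τ.2
      have hYm : ∀ x ∈ (oneLineB v₀).map f, x ∈ (Y : Set ℤ) := fun x hx => by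
        rw [← hσ, mem_oneLineA] at hx
        exact hx
      have hs' := hs.map hYm hg
      rw [map_map_of_perm hgf (List.Perm.refl _)] at hs'
      obtain ⟨w, hw⟩ := exists_oneLineB_of_perm hs'.perm
      refine ⟨⟨w, (hE w).2 (hw ▸ hs')⟩, ?_⟩
      apply Subtype.ext
      apply oneLineA_injective
      rw [he, hw]
      refine map_map_of_perm (l := (oneLineB v₀).map f) (fun y hy => ?_) hs.perm
      obtain ⟨x, hx, rfl⟩ := List.mem_map.1 hy
      rw [hgf x hx]
  refine ⟨Equiv.ofBijective e hbij, fun v w => ⟨fun h => ?_, fun h => ?_⟩⟩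
  · simp only [Equiv.ofBijective_apply, he]
    exact h.map (fun x hx => (hEp v).mem_iff.2 hx) hf
  · simp only [Equiv.ofBijective_apply, he] at h
    rw [← hback v, ← hback w]
    refine h.map (fun x hx => ?_) hg
    obtain ⟨y, hy, rfl⟩ := List.mem_map.1 hx
    exact hfY y ((hEp v).mem_iff.2 hy)

theorem existsUnique_minimal_and_minimum {m : hyperoctahedral n} (hm : m ∈ E)
    (h : ∀ w ∈ E, LeA (oneLineB m) (oneLineB w)) :
    (∃! m, m ∈ E ∧ ∀ w ∈ E, ¬ LtA (oneLineB w) (oneLineB m)) ∧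
    (∃! m, m ∈ E ∧ ∀ w ∈ E, LeA (oneLineB m) (oneLineB w)) := by
  refine ⟨⟨m, ⟨hm, fun w hw hlt => ?_⟩, fun m' hm' => ?_⟩, ⟨m, ⟨hm, h⟩, fun m' hm' => ?_⟩⟩
  · rcases h w hw with h1 | h1
    · exact LtA.irrefl _ (h1 ▸ hlt)
    · exact LtA.irrefl _ (h1.trans hlt)
  · rcases h m' hm'.1 with h1 | h1
    · exact oneLineB_injective h1.symm
    · exact absurd h1 (hm'.2 m hm)
  · exact oneLineB_injective ((hm'.2 m hm).antisymm (h m' hm'.1))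

theorem existsUnique_maximal_and_maximum {m : hyperoctahedral n} (hm : m ∈ E)
    (h : ∀ w ∈ E, LeA (oneLineB w) (oneLineB m)) :
    (∃! m, m ∈ E ∧ ∀ w ∈ E, ¬ LtA (oneLineB m) (oneLineB w)) ∧
    (∃! m, m ∈ E ∧ ∀ w ∈ E, LeA (oneLineB w) (oneLineB m)) := by
  refine ⟨⟨m, ⟨hm, fun w hw hlt => ?_⟩, fun m' hm' => ?_⟩, ⟨m, ⟨hm, h⟩, fun m' hm' => ?_⟩⟩
  · rcases h w hw with h1 | h1
    · exact LtA.irrefl _ (h1 ▸ hlt)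
    · exact LtA.irrefl _ (h1.trans hlt)
  · rcases h m' hm'.1 with h1 | h1
    · exact oneLineB_injective h1
    · exact absurd h1 (hm'.2 m hm)
  · exact oneLineB_injective ((h m' hm'.1).antisymm (hm'.2 m hm))

/-- Two finite sets of integers of the same size are related by an increasing bijection. -/
theorem exists_strictMonoOn_bijection {X Y : Finset ℤ} (h : X.card = Y.card) :
    ∃ f g : ℤ → ℤ, StrictMonoOn f X ∧ StrictMonoOn g Y ∧ (∀ x ∈ X, g (f x) = x) ∧
      ∀ y, y ∈ Y ↔ ∃ x ∈ X, f x = y := by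
  let e : X ≃o Y := (X.orderIsoOfFin h).symm.trans (Y.orderIsoOfFin rfl)
  refine ⟨fun x => if hx : x ∈ X then e ⟨x, hx⟩ else 0,
    fun y => if hy : y ∈ Y then e.symm ⟨y, hy⟩ else 0, ?_, ?_, ?_, ?_⟩
  · intro a ha b hb hab
    simp only [dif_pos (Finset.mem_coe.1 ha), dif_pos (Finset.mem_coe.1 hb)]
    exact e.strictMono (a := ⟨a, ha⟩) (b := ⟨b, hb⟩) hab
  · intro a ha b hb hab
    simp only [dif_pos (Finset.mem_coe.1 ha), dif_pos (Finset.mem_coe.1 hb)]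
    exact e.symm.strictMono (a := ⟨a, ha⟩) (b := ⟨b, hb⟩) hab
  · intro x hx
    simp [hx]
  · intro y
    constructor
    · intro hy
      exact ⟨e.symm ⟨y, hy⟩, (e.symm ⟨y, hy⟩).2, by simp⟩
    · rintro ⟨x, hx, rfl⟩
      simp only [dif_pos hx]
      exact (e ⟨x, hx⟩).2

end Main

end SignedAtoms

theorem mainTheorem5 (n : ℕ) (z : SignedAtoms.hyperoctahedral n) (hz : z⁻¹ = z)
    (E : Set (SignedAtoms.hyperoctahedral n)) (hE : SignedAtoms.IsSimClass z E) :
    -- `E` is the embedded image of `𝒜(ζ)⁻¹` for an involution `ζ` of some `S_X`, as a poset too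
    (∃ (X : Finset ℤ) (hX : SignedAtoms.IsHalf n X) (ζ : Equiv.Perm X),
      ζ⁻¹ = ζ ∧ E = SignedAtoms.embedSet hX ζ ∧ SignedAtoms.IsoAtomPoset E ζ) ∧
    -- `E` has a unique minimal element, and it is the minimum of `E`
    (∃! m, m ∈ E ∧ ∀ w ∈ E, ¬ SignedAtoms.LtA (SignedAtoms.oneLineB w) (SignedAtoms.oneLineB m)) ∧
    (∃! m, m ∈ E ∧ ∀ w ∈ E, SignedAtoms.LeA (SignedAtoms.oneLineB m) (SignedAtoms.oneLineB w)) ∧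
    -- `E` has a unique maximal element, and it is the maximum of `E`
    (∃! m, m ∈ E ∧ ∀ w ∈ E, ¬ SignedAtoms.LtA (SignedAtoms.oneLineB m) (SignedAtoms.oneLineB w)) ∧
    (∃! m, m ∈ E ∧ ∀ w ∈ E, SignedAtoms.LeA (SignedAtoms.oneLineB w) (SignedAtoms.oneLineB m)) ∧
    -- `(E, <_A)` is isomorphic to the poset `𝒜(ζ)⁻¹` of an involution `ζ` of `{1, …, n}`
    (∃ ζ : Equiv.Perm (Finset.Icc (1 : ℤ) n), ζ⁻¹ = ζ ∧ SignedAtoms.IsoAtomPoset E ζ) := by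
  open SignedAtoms in
  obtain ⟨v₀, hv₀, rfl⟩ := hE
  -- Closure of `𝒜(z)⁻¹` under `∼_A` makes the atom condition redundant: `E` consists of all words
  -- equivalent to that of `v₀`.
  have hE : ∀ w, w ∈ {w | w ∈ invAtoms (simpleB n) z ∧ SimA (oneLineB v₀) (oneLineB w)} ↔
      SimA (oneLineB v₀) (oneLineB w) :=
    fun w => ⟨fun h => h.2, fun h => ⟨mem_invAtomsB_of_simA hv₀ h, h⟩⟩
  generalize {w | w ∈ invAtoms (simpleB n) z ∧ SimA (oneLineB v₀) (oneLineB w)} = E at hE ⊢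
  have hfree := isDescentFree_of_mem_invAtomsB hv₀
  have hd := oneLineB_nodup v₀
  obtain ⟨lm, hm, hm'⟩ := hfree.exists_minimum hd
  obtain ⟨m, rfl⟩ := exists_oneLineB_of_perm hm.perm
  obtain ⟨lM, hM, hM'⟩ := hfree.exists_maximum hd
  obtain ⟨M, rfl⟩ := exists_oneLineB_of_perm hM.perm
  have hmin := existsUnique_minimal_and_minimum ((hE m).2 hm) fun w hw => hm' _ ((hE w).1 hw)
  have hmax := existsUnique_maximal_and_maximum ((hE M).2 hM) fun w hw => hM' _ ((hE w).1 hw)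
  have hX := isHalf_toFinset v₀
  refine ⟨⟨_, hX, ?_⟩, hmin.1, hmin.2, hmax.1, hmax.2, ?_⟩
  -- `X` is the set of letters of `v₀`, with the trivial relabelling.
  · obtain ⟨ζ, h1, h2, h3⟩ := exists_isoAtomPoset (Y := (oneLineB v₀).toFinset) hE hfree
      (f := id) (g := id) strictMonoOn_id strictMonoOn_id (fun _ _ => rfl) (by simp)
    refine ⟨ζ, h1, ?_, h2⟩
    rw [List.map_id] at h3
    ext w
    rw [hE, embedSet, Set.mem_image]
    constructor
    · intro h
      obtain ⟨τ, hτ⟩ := exists_oneLineA_eq (X := (oneLineB v₀).toFinset) (oneLineB_nodup w)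
        fun a => by rw [List.mem_toFinset, h.perm.mem_iff]
      exact ⟨τ, (h3 τ).2 (hτ ▸ h), oneLineB_injective ((oneLineB_embed hX τ).trans hτ)⟩
    · rintro ⟨τ, hτ, rfl⟩
      rw [oneLineB_embed]
      exact (h3 τ).1 hτ
  -- A half of `[±n]` has `n` elements, so the increasing bijection onto `{1, …, n}` serves as
  -- relabelling.
  · have hcard : (oneLineB v₀).toFinset.card = (Finset.Icc (1 : ℤ) n).card := by
      rw [hX.card]
      simp
    obtain ⟨f, g, hf, hg, hgf, hY⟩ := exists_strictMonoOn_bijection hcard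
    obtain ⟨ζ, h1, h2, -⟩ := exists_isoAtomPoset hE hfree (f := f) (g := g)
      (by simpa [StrictMonoOn] using hf) hg (by simpa using hgf) (by simpa using hY)
    exact ⟨ζ, h1, h2⟩
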